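/- **Setting.** Let $\Bbbk=\mathbb R$ or $\mathbb C$, let $U\subseteq\mathbb R^n$ be an open coordinate domain, and consider physical fields $\phi^1,\dots,\phi^m$ together with $N$ canonically conjugate pairs $(q^i,q^\dagger_i)$ of BV-variables, $q^i$ of even and $q^\dagger_i$ of odd ghost parity. A *density* $f(x,[\phi],[q],[q^\dagger])$ is a polynomial in the anticommuting jet variables $q^\dagger_{i,\sigma}$ whose coefficients are $\Bbbk$-valued functions depending smoothly on $x\in U$ and on finitely many jet variables $\phi^j_\sigma,q^i_\sigma$. *Legs.* In the product-bundle geometry every variation lives over its own copy of the base, and the integrations by parts are postponed. The total derivatives which they produce wait until all variations are over. A *leg* is therefore a formal finite sum $\sum_\sigma p^\sigma f_\sigma$ of densities with multi-indices $\sigma$, where $p^\sigma$ stands for the waiting total derivative $(\mathrm d/\mathrm d x)^\sigma$; $p$ commutes with all partial derivatives along the jet variables. On legs, put $$\delta_i=\sum_\sigma(-p)^\sigma\frac{\partial}{\partial q^i_\sigma},\qquad \delta_i^\dagger=\sum_\sigma(-p)^\sigma\frac{\overrightarrow\partial}{\partial q^\dagger_{i,\sigma}} .$$ *Integral functionals.*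 The building blocks $\int f(x,[\phi],[q],[q^\dagger])\,\mathrm{dvol}(x)$ and their descendants, which have absorbed any number of variations, are represented by sums of products of a smooth function on $U$ with finitely many graded-commuting legs (all to be restricted to one base point $x$); they form a graded-commutative algebra, to which $\delta_i$ and $\delta_i^\dagger$ extend as an even and an odd left derivation. A test shift $\delta\boldsymbol s=(\delta s^i,\delta s^\dagger_i)$ consists of smooth functions on $U$; it is *normalized* if $\delta s^i(x)\cdot\delta s^\dagger_i(x)\equiv1$ for every $i$ (no summation). On integral functionals, the BV-Laplacian and the variational Schouten bracket with the test shift $\delta\boldsymbol s$ are $$\Delta F=\sum_i\delta s^i\,\delta s^\dagger_i\;\delta_i\delta^\dagger_iF,\qquad [\![F,G]\!]=\sum_i\delta s^i\,\delta s_i^\dagger\,\Bigl(\delta_iF\cdot\delta_i^\dagger G-(F)\overleftarrow{\delta}{}^{\dagger}_i\cdot\delta_iG\Bigr),$$ where $(F)\overleftarrow\delta{}^\dagger_i=(-1)^{\mathrm{gh}(F)-1}\delta_i^\dagger F$. *Local functionals.* Let $\overline{\mathfrak N}$ be the space of formal sums of formal graded-commutative products of integral functionals. The two operations extend to $\overline{\mathfrak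 N}$ by linearity and by $$\Delta(F\cdot G)=\Delta F\cdot G+(-1)^{\mathrm{gh}(F)}[\![F,G]\!]+(-1)^{\mathrm{gh}(F)}F\cdot\Delta G,$$ $$[\![F,G\cdot H]\!]=[\![F,G]\!]\cdot H+(-1)^{(\mathrm{gh}(F)-1)\mathrm{gh}(G)}G\cdot[\![F,H]\!],\qquad [\![F\cdot G,H]\!]=F\cdot[\![G,H]\!]+(-1)^{\mathrm{gh}(G)(\mathrm{gh}(H)-1)}[\![F,H]\!]\cdot G .$$ Given a volume element $\mathrm{dvol}=\rho\,\mathrm d x$, an element of $\overline{\mathfrak N}$ is *evaluated* by applying the waiting total derivatives to every leg, multiplying the legs, the coefficient and $\rho$ at the common base point, and taking the class of each resulting density in the horizontal cohomology group $\overline H{}^n$ (densities modulo total divergences); the value is a formal sum of products of elements of $\overline H{}^n$. **Theorem.** Let $\delta\boldsymbol s_1$ and $\delta\boldsymbol s_2$ be normalized test shifts; use $\delta\boldsymbol s_1$ in $\Delta$ and $\delta\boldsymbol s_2$ in $[\![\,,\,]\!]$. 1. For all integral functionals $F$ and $G$ with $F$ homogeneous of ghost parity $\mathrm{gh}(F)$,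 $$\Delta\bigl([\![F,G]\!]\bigr)=[\![\Delta F,G]\!]+(-1)^{\mathrm{gh}(F)-1}[\![F,\Delta G]\!].$$ 2. The same equality holds for all $F,G\in\overline{\mathfrak N}$ with $F$ homogeneous of ghost parity $\mathrm{gh}(F)$; that is, $\Delta$ is a graded derivation of the variational Schouten bracket. 3. Consequently, for every volume element, the two sides in 2. have equal values after the evaluation. -/

import Mathlib

open scoped TensorProduct ContDiff

noncomputable section

namespace BV

/-- A super vector space: a vector space with a parity involution. Even vectors are those with
`op v = v`, odd vectors are those with `op v = -v`. -/
structure Parity (𝕜 V : Type*) [Field 𝕜] [AddCommGroup V] [Module 𝕜 V] where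
  op : V →ₗ[𝕜] V
  op_op : ∀ v, op (op v) = v

section Super

variable {𝕜 : Type*} [Field 𝕜] {V : Type*} [AddCommGroup V] [Module 𝕜 V]

/-- The even component of a vector. -/
def Parity.ev (P : Parity 𝕜 V) : V →ₗ[𝕜] V := (2⁻¹ : 𝕜) • (LinearMap.id + P.op)

/-- The odd component of a vector. -/
def Parity.od (P : Parity 𝕜 V) : V →ₗ[𝕜] V := (2⁻¹ : 𝕜) • (LinearMap.id - P.op)

/-- `F` is homogeneous of ghost parity `a` (only the residue of `a` modulo two matters). -/
def Parity.IsHomogeneous (P : Parity 𝕜 V) (a : ℤ) (F : V) : Prop := P.op F = (-1 : 𝕜) ^ a • F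

variable (P : Parity 𝕜 V)

theorem Parity.op_ev (v : V) : P.op (P.ev v) = P.ev v := by
  simp [Parity.ev, P.op_op, add_comm]

theorem Parity.op_od (v : V) : P.op (P.od v) = -P.od v := by
  simp only [Parity.od, LinearMap.smul_apply, LinearMap.sub_apply, LinearMap.id_apply, map_smul,
    map_sub, P.op_op, ← smul_neg, neg_sub]

theorem Parity.ev_add_od [CharZero 𝕜] (v : V) : P.ev v + P.od v = v := by
  simp only [Parity.ev, Parity.od, LinearMap.smul_apply, LinearMap.sub_apply, LinearMap.add_apply,
    LinearMap.id_apply]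
  rw [← smul_add, add_add_sub_cancel, ← two_smul 𝕜 v, smul_smul, inv_mul_cancel₀ two_ne_zero,
    one_smul]

theorem Parity.ev_even [CharZero 𝕜] {v : V} (h : P.op v = v) : P.ev v = v ∧ P.od v = 0 := by
  have : P.od v = 0 := by simp [Parity.od, h]
  refine ⟨?_, this⟩
  have h2 := P.ev_add_od v
  rwa [this, add_zero] at h2

theorem Parity.ev_odd [CharZero 𝕜] {v : V} (h : P.op v = -v) : P.ev v = 0 ∧ P.od v = v := by
  have : P.ev v = 0 := by simp [Parity.ev, h]
  refine ⟨this, ?_⟩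
  have h2 := P.ev_add_od v
  rwa [this, zero_add] at h2

/-- Graded commutativity `y x = (-1)^{|x||y|} x y` of an algebra with parity. -/
def SuperComm {A : Type*} [Ring A] [Algebra 𝕜 A] (P : Parity 𝕜 A) : Prop :=
  ∀ x y, (P.op x = x → y * x = x * y) ∧ (P.op x = -x → y * x = x * P.op y)

/-- The relations of graded commutativity among the generators. -/
inductive SuperSym.Rel : TensorAlgebra 𝕜 V → TensorAlgebra 𝕜 V → Prop
  | even (a b : V) (ha : P.op a = a) :
      SuperSym.Rel (TensorAlgebra.ι 𝕜 a * TensorAlgebra.ι 𝕜 b)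
        (TensorAlgebra.ι 𝕜 b * TensorAlgebra.ι 𝕜 a)
  | odd (a b : V) (ha : P.op a = -a) (hb : P.op b = -b) :
      SuperSym.Rel (TensorAlgebra.ι 𝕜 a * TensorAlgebra.ι 𝕜 b)
        (-(TensorAlgebra.ι 𝕜 b * TensorAlgebra.ι 𝕜 a))

/-- The graded-symmetric algebra of a super vector space: formal sums of formal products of
vectors, where the factors graded-commute. -/
def SuperSym : Type _ := RingQuot (SuperSym.Rel P)

instance : Ring (SuperSym P) := inferInstanceAs (Ring (RingQuot (SuperSym.Rel P)))
instance : Algebra 𝕜 (SuperSym P) := inferInstanceAs (Algebra 𝕜 (RingQuot (SuperSym.Rel P)))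

namespace SuperSym

/-- The inclusion of generators. -/
def ι : V →ₗ[𝕜] SuperSym P :=
  (RingQuot.mkAlgHom 𝕜 (SuperSym.Rel P)).toLinearMap ∘ₗ TensorAlgebra.ι 𝕜

variable {P}

theorem ι_even {a : V} (ha : P.op a = a) (b : V) : ι P a * ι P b = ι P b * ι P a := by
  have := RingQuot.mkAlgHom_rel 𝕜 (SuperSym.Rel.even (P := P) a b ha)
  rw [map_mul, map_mul] at this
  exact this

theorem ι_odd {a b : V} (ha : P.op a = -a) (hb : P.op b = -b) :
    ι P a * ι P b = -(ι P b * ι P a) := by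
  have := RingQuot.mkAlgHom_rel 𝕜 (SuperSym.Rel.odd (P := P) a b ha hb)
  rw [map_mul, map_neg, map_mul] at this
  exact this

section Lift

variable {E : Type*} [Ring E] [Algebra 𝕜 E] (f : V →ₗ[𝕜] E)
  (he : ∀ a b, P.op a = a → f a * f b = f b * f a)
  (ho : ∀ a b, P.op a = -a → P.op b = -b → f a * f b = -(f b * f a))

/-- The universal property of the graded-symmetric algebra. -/
def lift : SuperSym P →ₐ[𝕜] E :=
  RingQuot.liftAlgHom 𝕜 ⟨TensorAlgebra.lift 𝕜 f, by
    intro x y h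
    cases h with
    | even a b ha => simpa using he a b ha
    | odd a b ha hb => simpa using ho a b ha hb⟩

theorem lift_ι (v : V) : lift f he ho (ι P v) = f v := by
  change RingQuot.liftAlgHom 𝕜 _ (RingQuot.mkAlgHom 𝕜 _ _) = _
  rw [RingQuot.liftAlgHom_mkAlgHom_apply]
  simp

end Lift

theorem induction {C : SuperSym P → Prop} (halg : ∀ r, C (algebraMap 𝕜 _ r))
    (hι : ∀ v, C (ι P v)) (hmul : ∀ x y, C x → C y → C (x * y))
    (hadd : ∀ x y, C x → C y → C (x + y)) (x : SuperSym P) : C x := by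
  obtain ⟨t, rfl⟩ := RingQuot.mkAlgHom_surjective 𝕜 (SuperSym.Rel P) x
  induction t using TensorAlgebra.induction with
  | algebraMap r => rw [AlgHom.commutes]; exact halg r
  | ι v => exact hι v
  | mul a b ha hb => rw [map_mul]; exact hmul _ _ ha hb
  | add a b ha hb => rw [map_add]; exact hadd _ _ ha hb

/-- The parity automorphism, extended multiplicatively from the generators. -/
def parHom (P : Parity 𝕜 V) : SuperSym P →ₐ[𝕜] SuperSym P :=
  lift (ι P ∘ₗ P.op)
    (fun a b ha => by simp only [LinearMap.comp_apply, ha]; exact ι_even ha _)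
    (fun a b ha hb => by
      simp only [LinearMap.comp_apply, ha, hb, map_neg, neg_mul_neg]; exact ι_odd ha hb)

theorem parHom_ι (v : V) : parHom P (ι P v) = ι P (P.op v) := lift_ι _ _ _ v

theorem parHom_parHom (x : SuperSym P) : parHom P (parHom P x) = x := by
  induction x using SuperSym.induction with
  | halg r => simp only [AlgHom.commutes]
  | hι v => rw [parHom_ι, parHom_ι, P.op_op]
  | hmul x y hx hy => rw [map_mul, map_mul, hx, hy]
  | hadd x y hx hy => rw [map_add, map_add, hx, hy]

/-- The graded-symmetric algebra is again a super vector space. -/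
def par (P : Parity 𝕜 V) : Parity 𝕜 (SuperSym P) := ⟨(parHom P).toLinearMap, parHom_parHom⟩

theorem par_ι (v : V) : (par P).op (ι P v) = ι P (P.op v) := parHom_ι v

theorem par_mul (x y : SuperSym P) : (par P).op (x * y) = (par P).op x * (par P).op y :=
  map_mul (parHom P) x y

variable [CharZero 𝕜]

theorem ι_mul_even {v : V} (hv : P.op v = v) (x : SuperSym P) : ι P v * x = x * ι P v := by
  induction x using SuperSym.induction with
  | halg r => exact (Algebra.commutes r _).symm
  | hι w => exact ι_even hv w
  | hmul x y hx hy => rw [← mul_assoc, hx, mul_assoc, hy, mul_assoc]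
  | hadd x y hx hy => rw [mul_add, add_mul, hx, hy]

theorem ι_mul_odd {v : V} (hv : P.op v = -v) (x : SuperSym P) :
    ι P v * x = (par P).op x * ι P v := by
  induction x using SuperSym.induction with
  | halg r =>
    have : (par P).op (algebraMap 𝕜 _ r) = algebraMap 𝕜 _ r := (parHom P).commutes r
    rw [this]; exact (Algebra.commutes r _).symm
  | hι w =>
    rw [par_ι]
    conv_lhs => rw [← P.ev_add_od w]
    conv_rhs => rw [← P.ev_add_od w]
    rw [map_add P.op, P.op_ev, P.op_od]
    simp only [map_add, map_neg, mul_add, add_mul, neg_mul]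
    rw [ι_odd hv (P.op_od w), ι_even (P.op_ev w)]
  | hmul x y hx hy => rw [← mul_assoc, hx, mul_assoc, hy, par_mul, mul_assoc]
  | hadd x y hx hy => rw [mul_add, map_add, add_mul, hx, hy]

theorem superComm (P : Parity 𝕜 V) : SuperComm (par P) := by
  intro x y
  constructor
  · intro hx
    induction y using SuperSym.induction with
    | halg r => exact Algebra.commutes r _
    | hι v =>
      rw [← P.ev_add_od v, map_add, add_mul, mul_add, ι_mul_even (P.op_ev v),
        ι_mul_odd (P.op_od v), hx]
    | hmul y z hy hz => rw [mul_assoc, hz, ← mul_assoc, hy, mul_assoc]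
    | hadd y z hy hz => rw [mul_add, add_mul, hy, hz]
  · intro hx
    induction y using SuperSym.induction with
    | halg r =>
      have : (par P).op (algebraMap 𝕜 _ r) = algebraMap 𝕜 _ r := (parHom P).commutes r
      rw [this]; exact Algebra.commutes r _
    | hι v =>
      rw [← P.ev_add_od v, map_add, add_mul, map_add, mul_add, ι_mul_even (P.op_ev v),
        ι_mul_odd (P.op_od v), hx, par_ι, par_ι, P.op_ev, P.op_od, map_neg, mul_neg, neg_mul]
    | hmul y z hy hz => rw [mul_assoc, hz, ← mul_assoc, hy, mul_assoc, par_mul]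
    | hadd y z hy hz => rw [map_add, mul_add, add_mul, hy, hz]

section Recursion

variable {X : Type*} [AddCommGroup X] [Module 𝕜 X]
  (α : V →ₗ[𝕜] SuperSym P →ₗ[𝕜] X) (β : V →ₗ[𝕜] X →ₗ[𝕜] X)

/-- The condition under which the recursion `T 1 = 0`, `T (v * G) = α v G + β v (T G)`
respects graded commutativity. -/
structure RecCompat : Prop where
  even : ∀ a b, P.op a = a → ∀ G H,
    α a (ι P b * G) + β a (α b G + β b H) = α b (ι P a * G) + β b (α a G + β a H)
  odd : ∀ a b, P.op a = -a → P.op b = -b → ∀ G H,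
    α a (ι P b * G) + β a (α b G + β b H) = -(α b (ι P a * G) + β b (α a G + β a H))

/-- One step of the recursion, as an operator on pairs `(G, T G)`. -/
def recStep : V →ₗ[𝕜] Module.End 𝕜 (SuperSym P × X) where
  toFun v := LinearMap.prod (LinearMap.mulLeft 𝕜 (ι P v) ∘ₗ LinearMap.fst 𝕜 _ _)
    (α v ∘ₗ LinearMap.fst 𝕜 _ _ + β v ∘ₗ LinearMap.snd 𝕜 _ _)
  map_add' v w := by
    ext x <;> simp [add_mul]
  map_smul' c v := by
    ext x <;> simp

variable {α β}

/-- The action of the algebra on pairs generated by `recStep`. -/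
def recHom (h : RecCompat α β) : SuperSym P →ₐ[𝕜] Module.End 𝕜 (SuperSym P × X) :=
  lift (recStep α β)
    (fun a b ha => by
      refine LinearMap.ext fun p => Prod.ext ?_ (h.even a b ha p.1 p.2)
      change ι P a * (ι P b * p.1) = ι P b * (ι P a * p.1)
      rw [← mul_assoc, ι_even ha, mul_assoc])
    (fun a b ha hb => by
      refine LinearMap.ext fun p => Prod.ext ?_ (h.odd a b ha hb p.1 p.2)
      change ι P a * (ι P b * p.1) = -(ι P b * (ι P a * p.1))
      rw [← mul_assoc, ι_odd ha hb, neg_mul, mul_assoc])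

/-- The linear map `T` with `T 1 = 0` and `T (v * G) = α v G + β v (T G)`. -/
def recMap (h : RecCompat α β) : SuperSym P →ₗ[𝕜] X :=
  LinearMap.snd 𝕜 _ _ ∘ₗ LinearMap.applyₗ ((1, 0) : SuperSym P × X) ∘ₗ (recHom h).toLinearMap

theorem recHom_fst (h : RecCompat α β) (x : SuperSym P) (p : SuperSym P × X) :
    (recHom h x p).1 = x * p.1 := by
  induction x using SuperSym.induction generalizing p with
  | halg r => simp [Algebra.algebraMap_eq_smul_one]
  | hι v => rw [recHom, lift_ι]; rfl
  | hmul x y hx hy => rw [map_mul, Module.End.mul_apply, hx, hy, mul_assoc]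
  | hadd x y hx hy => rw [map_add, LinearMap.add_apply, Prod.fst_add, hx, hy, add_mul]

theorem recMap_one (h : RecCompat α β) : recMap h 1 = 0 := by
  simp [recMap]

theorem recMap_ι_mul (h : RecCompat α β) (v : V) (G : SuperSym P) :
    recMap h (ι P v * G) = α v G + β v (recMap h G) := by
  have h1 : recMap h (ι P v * G) = (recHom h (ι P v) (recHom h G (1, 0))).2 := by
    simp [recMap]
  have h2 : recHom h (ι P v) = recStep α β v := lift_ι _ _ _ v
  have h3 := recHom_fst h G (1, 0)
  rw [mul_one] at h3
  rw [h1, h2]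
  change α v (recHom h G (1, 0)).1 + β v (recHom h G (1, 0)).2 = _
  rw [h3]
  rfl

end Recursion

end SuperSym
end Super

section Extension

variable {𝕜 : Type*} [Field 𝕜] [CharZero 𝕜] {V : Type*} [AddCommGroup V] [Module 𝕜 V]
  {P : Parity 𝕜 V}

namespace SuperSym

theorem mul_ι_swap_odd {v : V} (hv : P.op v = -v) (w : V) :
    ι P v * ι P w = ι P (P.op w) * ι P v := by
  rw [ι_mul_odd hv, par_ι]

theorem evenCompat {d : V →ₗ[𝕜] V} (hd : ∀ v, P.op (d v) = d (P.op v)) :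
    RecCompat (P := P) (LinearMap.mul 𝕜 (SuperSym P) ∘ₗ ι P ∘ₗ d)
      (LinearMap.mul 𝕜 (SuperSym P) ∘ₗ ι P) where
  even a b ha G H := by
    have h1 : P.op (d a) = d a := by rw [hd, ha]
    simp only [LinearMap.comp_apply, LinearMap.mul_apply', mul_add, ← mul_assoc]
    rw [ι_even h1 b, ι_even ha (d b), ι_even ha b]
    abel
  odd a b ha hb G H := by
    have h1 : P.op (d a) = -d a := by rw [hd, ha, map_neg]
    have h2 : P.op (d b) = -d b := by rw [hd, hb, map_neg]
    simp only [LinearMap.comp_apply, LinearMap.mul_apply', mul_add, ← mul_assoc]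
    rw [ι_odd h1 hb, ι_odd ha h2, ι_odd ha hb]
    simp only [neg_mul]
    abel

/-- The even derivation of the graded-symmetric algebra that extends an even endomorphism
of the space of generators. -/
def evenExt (d : V →ₗ[𝕜] V) (hd : ∀ v, P.op (d v) = d (P.op v)) :
    SuperSym P →ₗ[𝕜] SuperSym P := recMap (evenCompat hd)

theorem oddCompat {d : V →ₗ[𝕜] V} (hd : ∀ v, P.op (d v) = -d (P.op v)) :
    RecCompat (P := P) (LinearMap.mul 𝕜 (SuperSym P) ∘ₗ ι P ∘ₗ d)
      (LinearMap.mul 𝕜 (SuperSym P) ∘ₗ ι P ∘ₗ P.op) where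
  even a b ha G H := by
    have h1 : P.op (d a) = -d a := by rw [hd, ha]
    simp only [LinearMap.comp_apply, LinearMap.mul_apply', mul_add, ← mul_assoc, ha]
    rw [mul_ι_swap_odd h1 b, ι_even ha (d b), ι_even ha (P.op b)]
    abel
  odd a b ha hb G H := by
    have h1 : P.op (d a) = d a := by rw [hd, ha, map_neg, neg_neg]
    have h2 : P.op (d b) = d b := by rw [hd, hb, map_neg, neg_neg]
    simp only [LinearMap.comp_apply, ha, hb, map_neg, LinearMap.neg_apply, LinearMap.mul_apply',
      mul_add, ← mul_assoc, mul_neg, neg_neg, neg_add]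
    rw [ι_even h1 b, ← ι_even h2 a, ι_odd ha hb]
    simp only [neg_mul]
    abel

/-- The odd (left) derivation of the graded-symmetric algebra that extends an odd endomorphism
of the space of generators. -/
def oddExt (d : V →ₗ[𝕜] V) (hd : ∀ v, P.op (d v) = -d (P.op v)) :
    SuperSym P →ₗ[𝕜] SuperSym P := recMap (oddCompat hd)

theorem evenExt_ι_mul (d : V →ₗ[𝕜] V) (hd : ∀ v, P.op (d v) = d (P.op v)) (v : V)
    (G : SuperSym P) : evenExt d hd (ι P v * G) = ι P (d v) * G + ι P v * evenExt d hd G :=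
  recMap_ι_mul (evenCompat hd) v G

theorem oddExt_ι_mul (d : V →ₗ[𝕜] V) (hd : ∀ v, P.op (d v) = -d (P.op v)) (v : V)
    (G : SuperSym P) :
    oddExt d hd (ι P v * G) = ι P (d v) * G + ι P (P.op v) * oddExt d hd G :=
  recMap_ι_mul (oddCompat hd) v G

theorem inductionLeft {C : SuperSym P → Prop} (h1 : C 1) (hsmul : ∀ (r : 𝕜) x, C x → C (r • x))
    (hadd : ∀ x y, C x → C y → C (x + y)) (hmul : ∀ v x, C x → C (ι P v * x))
    (x : SuperSym P) : C x := by
  have key : ∀ y, C y → C (x * y) := by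
    induction x using SuperSym.induction with
    | halg r => intro y hy; rw [← Algebra.smul_def]; exact hsmul r y hy
    | hι v => exact fun y hy => hmul v y hy
    | hmul a b ha hb => intro y hy; rw [mul_assoc]; exact ha _ (hb _ hy)
    | hadd a b ha hb => intro y hy; rw [add_mul]; exact hadd _ _ (ha _ hy) (hb _ hy)
  simpa using key 1 h1

theorem par_one : (par P).op (1 : SuperSym P) = 1 := map_one (parHom P)

theorem par_evenExt (d : V →ₗ[𝕜] V) (hd : ∀ v, P.op (d v) = d (P.op v)) (x : SuperSym P) :
    (par P).op (evenExt d hd x) = evenExt d hd ((par P).op x) := by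
  induction x using SuperSym.inductionLeft with
  | h1 => rw [par_one, evenExt, recMap_one, map_zero]
  | hsmul r x hx => simp only [map_smul, hx]
  | hadd x y hx hy => simp only [map_add, hx, hy]
  | hmul v x hx =>
    rw [evenExt_ι_mul, map_add, par_mul, par_mul, par_mul, par_ι, par_ι, hx, evenExt_ι_mul, hd]

theorem par_oddExt (d : V →ₗ[𝕜] V) (hd : ∀ v, P.op (d v) = -d (P.op v)) (x : SuperSym P) :
    (par P).op (oddExt d hd x) = -oddExt d hd ((par P).op x) := by
  induction x using SuperSym.inductionLeft with
  | h1 => rw [par_one, oddExt, recMap_one, map_zero, neg_zero]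
  | hsmul r x hx => simp only [map_smul, hx, smul_neg]
  | hadd x y hx hy => simp only [map_add, hx, hy, neg_add]
  | hmul v x hx =>
    rw [oddExt_ι_mul, map_add, par_mul, par_mul, par_mul, par_ι, par_ι, hx, par_ι,
      oddExt_ι_mul, hd, map_neg, neg_mul, mul_neg, neg_add]

/-- Functoriality of the graded-symmetric algebra in parity-preserving maps. -/
def map {W : Type*} [AddCommGroup W] [Module 𝕜 W] {Q : Parity 𝕜 W} (f : V →ₗ[𝕜] W)
    (hf : ∀ v, Q.op (f v) = f (P.op v)) : SuperSym P →ₐ[𝕜] SuperSym Q :=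
  lift (ι Q ∘ₗ f)
    (fun a b ha => ι_even (by rw [hf, ha]) _)
    (fun a b ha hb => ι_odd (by rw [hf, ha, map_neg]) (by rw [hf, hb, map_neg]))

/-- The algebra map out of the graded-symmetric algebra induced by a parity-preserving map to
a graded-commutative algebra. -/
def liftComm {E : Type*} [Ring E] [Algebra 𝕜 E] {Q : Parity 𝕜 E} (hQ : SuperComm Q)
    (f : V →ₗ[𝕜] E) (hf : ∀ v, Q.op (f v) = f (P.op v)) : SuperSym P →ₐ[𝕜] E :=
  lift f
    (fun a b ha => ((hQ (f a) (f b)).1 (by rw [hf, ha])).symm)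
    (fun a b ha hb => by
      rw [(hQ (f b) (f a)).2 (by rw [hf, hb, map_neg]), hf, ha, map_neg, mul_neg])

theorem par_liftComm {E : Type*} [Ring E] [Algebra 𝕜 E] {Q : Parity 𝕜 E} (hQ : SuperComm Q)
    (h1 : Q.op 1 = 1) (hm : ∀ x y, Q.op (x * y) = Q.op x * Q.op y)
    (f : V →ₗ[𝕜] E) (hf : ∀ v, Q.op (f v) = f (P.op v)) (x : SuperSym P) :
    Q.op (liftComm hQ f hf x) = liftComm hQ f hf ((par P).op x) := by
  induction x using SuperSym.inductionLeft with
  | h1 => rw [par_one, map_one, h1]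
  | hsmul r x hx => simp only [map_smul, hx]
  | hadd x y hx hy => simp only [map_add, hx, hy]
  | hmul v x hx =>
    have h : ∀ w, liftComm hQ f hf (ι P w) = f w := fun w => lift_ι _ _ _ w
    rw [map_mul, hm, hx, par_mul, map_mul, par_ι, h, h, hf]

end SuperSym

section Tensor

variable {R : Type*} [CommRing R] [Algebra 𝕜 R]

/-- Parity on a space of coefficients times vectors. -/
def tensorPar (R : Type*) [CommRing R] [Algebra 𝕜 R] (P : Parity 𝕜 V) : Parity 𝕜 (R ⊗[𝕜] V) where
  op := LinearMap.lTensor R P.op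
  op_op v := by
    rw [← LinearMap.comp_apply, ← LinearMap.lTensor_comp]
    have : P.op ∘ₗ P.op = LinearMap.id := LinearMap.ext P.op_op
    rw [this, LinearMap.lTensor_id, LinearMap.id_apply]

variable {W : Type*} [Ring W] [Algebra 𝕜 W] {Q : Parity 𝕜 W}

theorem tensorPar_mul (hQ : ∀ x y, Q.op (x * y) = Q.op x * Q.op y) (x y : R ⊗[𝕜] W) :
    (tensorPar R Q).op (x * y) = (tensorPar R Q).op x * (tensorPar R Q).op y := by
  induction x using TensorProduct.induction_on with
  | zero => simp
  | add a b ha hb => simp only [add_mul, map_add, ha, hb]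
  | tmul a b =>
    induction y using TensorProduct.induction_on with
    | zero => simp
    | add a b ha hb => simp only [mul_add, map_add, ha, hb]
    | tmul c d => simp [tensorPar, hQ]

theorem tensorPar_ev (r : R) (w : W) : (tensorPar R Q).ev (r ⊗ₜ w) = r ⊗ₜ Q.ev w := by
  simp [tensorPar, Parity.ev, TensorProduct.tmul_add]

theorem tensorPar_od (r : R) (w : W) : (tensorPar R Q).od (r ⊗ₜ w) = r ⊗ₜ Q.od w := by
  simp [tensorPar, Parity.od, TensorProduct.tmul_sub]

theorem tensorPar_superComm (hQ : SuperComm Q) : SuperComm (tensorPar R Q) := by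
  intro x y
  constructor
  · intro hx
    rw [← (Parity.ev_even _ hx).1]
    clear hx
    induction x using TensorProduct.induction_on with
    | zero => simp
    | add a b ha hb => simp only [mul_add, add_mul, map_add, ha, hb]
    | tmul a b =>
      rw [tensorPar_ev]
      induction y using TensorProduct.induction_on with
      | zero => simp
      | add a b ha hb => simp only [mul_add, add_mul, ha, hb]
      | tmul c d =>
        rw [Algebra.TensorProduct.tmul_mul_tmul, Algebra.TensorProduct.tmul_mul_tmul, mul_comm,
          (hQ (Q.ev b) d).1 (Q.op_ev b)]
  · intro hx
    rw [← (Parity.ev_odd _ hx).2]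
    clear hx
    induction x using TensorProduct.induction_on with
    | zero => simp
    | add a b ha hb => simp only [mul_add, add_mul, map_add, ha, hb]
    | tmul a b =>
      rw [tensorPar_od]
      induction y using TensorProduct.induction_on with
      | zero => simp
      | add a b ha hb => simp only [mul_add, add_mul, map_add, ha, hb]
      | tmul c d =>
        change _ = a ⊗ₜ[𝕜] Q.od b * c ⊗ₜ[𝕜] Q.op d
        rw [Algebra.TensorProduct.tmul_mul_tmul, Algebra.TensorProduct.tmul_mul_tmul, mul_comm,
          (hQ (Q.od b) d).2 (Q.op_od b)]

end Tensor

end Extension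

section Jets

/-- Multi-indices `σ` over `n` independent variables. -/
abbrev MultiIndex (n : ℕ) : Type := Fin n →₀ ℕ

/-- Labels `(i, σ)` of the jet coordinates `q^i_σ`. -/
abbrev JetIndex (n : ℕ) (I : Type) : Type := I × MultiIndex n

/-- `(i, σ) ↦ (i, σ + 1_k)`. -/
def JetIndex.shift {n : ℕ} {I : Type} (k : Fin n) (s : JetIndex n I) : JetIndex n I :=
  (s.1, s.2 + Finsupp.single k 1)

variable (𝕜 : Type) [RCLike 𝕜] {n : ℕ} (U : TopologicalSpace.Opens (Fin n → ℝ)) (I : Type)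

/-- A differential function `f(x, [u])` on the infinite jet space over `U`: it depends smoothly on
`x ∈ U` and on finitely many jet coordinates. -/
def IsDiffFun (f : U → (JetIndex n I → ℝ) → 𝕜) : Prop :=
  ∃ (S : Finset (JetIndex n I)) (g : (Fin n → ℝ) × (S → ℝ) → 𝕜),
    ContDiffOn ℝ ∞ g ((U : Set (Fin n → ℝ)) ×ˢ Set.univ) ∧
      ∀ x u, f x u = g (x, fun s => u s)

variable {𝕜 U I}

theorem IsDiffFun.mono {S T : Finset (JetIndex n I)} (hST : S ⊆ T)
    {g : (Fin n → ℝ) × (S → ℝ) → 𝕜}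
    (hg : ContDiffOn ℝ ∞ g ((U : Set (Fin n → ℝ)) ×ˢ Set.univ)) :
    ∃ g' : (Fin n → ℝ) × (T → ℝ) → 𝕜,
      ContDiffOn ℝ ∞ g' ((U : Set (Fin n → ℝ)) ×ˢ Set.univ) ∧
        ∀ x (u : JetIndex n I → ℝ), g' (x, fun s => u s) = g (x, fun s => u s) := by
  refine ⟨fun p => g (p.1, fun s => p.2 ⟨s, hST s.2⟩), ?_, fun x u => rfl⟩
  refine hg.comp (s := (U : Set (Fin n → ℝ)) ×ˢ Set.univ)
    (f := fun p : (Fin n → ℝ) × (T → ℝ) => (p.1, fun s : S => p.2 ⟨s, hST s.2⟩)) ?_ ?_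
  · exact ContDiff.contDiffOn (by fun_prop)
  · exact fun p hp => ⟨hp.1, trivial⟩

theorem IsDiffFun.common {f₁ f₂ : U → (JetIndex n I → ℝ) → 𝕜} (h₁ : IsDiffFun 𝕜 U I f₁)
    (h₂ : IsDiffFun 𝕜 U I f₂) :
    ∃ (S : Finset (JetIndex n I)) (g₁ g₂ : (Fin n → ℝ) × (S → ℝ) → 𝕜),
      (ContDiffOn ℝ ∞ g₁ ((U : Set (Fin n → ℝ)) ×ˢ Set.univ) ∧
        ∀ x u, f₁ x u = g₁ (x, fun s => u s)) ∧
      (ContDiffOn ℝ ∞ g₂ ((U : Set (Fin n → ℝ)) ×ˢ Set.univ) ∧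
        ∀ x u, f₂ x u = g₂ (x, fun s => u s)) := by
  classical
  obtain ⟨S₁, g₁, hg₁, e₁⟩ := h₁
  obtain ⟨S₂, g₂, hg₂, e₂⟩ := h₂
  obtain ⟨g₁', h₁', e₁'⟩ := IsDiffFun.mono (Finset.subset_union_left (s₂ := S₂)) hg₁
  obtain ⟨g₂', h₂', e₂'⟩ := IsDiffFun.mono (Finset.subset_union_right (s₁ := S₁)) hg₂
  exact ⟨S₁ ∪ S₂, g₁', g₂', ⟨h₁', fun x u => by rw [e₁, e₁']⟩, ⟨h₂', fun x u => by rw [e₂, e₂']⟩⟩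

variable (𝕜 U I)

/-- The algebra of differential functions. -/
def diffFunAlg : Subalgebra 𝕜 (U → (JetIndex n I → ℝ) → 𝕜) where
  carrier := {f | IsDiffFun 𝕜 U I f}
  mul_mem' h₁ h₂ := by
    obtain ⟨S, g₁, g₂, ⟨h₁, e₁⟩, h₂, e₂⟩ := IsDiffFun.common h₁ h₂
    exact ⟨S, fun p => g₁ p * g₂ p, h₁.mul h₂, fun x u => by simp [e₁, e₂]⟩
  add_mem' h₁ h₂ := by
    obtain ⟨S, g₁, g₂, ⟨h₁, e₁⟩, h₂, e₂⟩ := IsDiffFun.common h₁ h₂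
    exact ⟨S, fun p => g₁ p + g₂ p, h₁.add h₂, fun x u => by simp [e₁, e₂]⟩
  algebraMap_mem' r := ⟨∅, fun _ => r, contDiffOn_const, fun x u => rfl⟩

/-- The algebra of smooth functions on `U`. -/
def smoothFunAlg : Subalgebra 𝕜 (U → 𝕜) where
  carrier := {f | ∃ g : (Fin n → ℝ) → 𝕜, ContDiffOn ℝ ∞ g U ∧ ∀ x : U, f x = g x}
  mul_mem' := by
    rintro _ _ ⟨g₁, h₁, e₁⟩ ⟨g₂, h₂, e₂⟩
    exact ⟨fun p => g₁ p * g₂ p, h₁.mul h₂, fun x => by simp [e₁, e₂]⟩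
  add_mem' := by
    rintro _ _ ⟨g₁, h₁, e₁⟩ ⟨g₂, h₂, e₂⟩
    exact ⟨fun p => g₁ p + g₂ p, h₁.add h₂, fun x => by simp [e₁, e₂]⟩
  algebraMap_mem' r := ⟨fun _ => r, contDiffOn_const, fun x => rfl⟩

/-- Differential functions. -/
def DiffFun : Type := diffFunAlg 𝕜 U I

instance : CommRing (DiffFun 𝕜 U I) := inferInstanceAs (CommRing (diffFunAlg 𝕜 U I))
instance : Algebra 𝕜 (DiffFun 𝕜 U I) := inferInstanceAs (Algebra 𝕜 (diffFunAlg 𝕜 U I))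

/-- Smooth functions on `U`. -/
def SmoothFun : Type := smoothFunAlg 𝕜 U

instance : CommRing (SmoothFun 𝕜 U) := inferInstanceAs (CommRing (smoothFunAlg 𝕜 U))
instance : Algebra 𝕜 (SmoothFun 𝕜 U) := inferInstanceAs (Algebra 𝕜 (smoothFunAlg 𝕜 U))

/-- A smooth function on `U` is a differential function. -/
def SmoothFun.toDiffFun : SmoothFun 𝕜 U →ₐ[𝕜] DiffFun 𝕜 U I where
  toFun r := ⟨fun x _ => r.1 x, by
    obtain ⟨g, hg, e⟩ := r.2
    exact ⟨∅, fun p => g p.1, hg.comp contDiff_fst.contDiffOn (fun p hp => hp.1),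
      fun x u => e x⟩⟩
  map_one' := rfl
  map_mul' _ _ := rfl
  map_zero' := rfl
  map_add' _ _ := rfl
  commutes' _ := rfl

/-- The jet coordinate `u_s` as a differential function. -/
def DiffFun.coord (s : JetIndex n I) : DiffFun 𝕜 U I :=
  ⟨fun _ u => (u s : 𝕜), {s}, fun p => ((p.2 ⟨s, Finset.mem_singleton_self s⟩ : ℝ) : 𝕜), by
    have h : ContDiff ℝ ∞ (fun p : (Fin n → ℝ) × (({s} : Finset (JetIndex n I)) → ℝ) =>
        p.2 ⟨s, Finset.mem_singleton_self s⟩) := by fun_prop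
    exact ((RCLike.ofRealCLM (K := 𝕜)).contDiff.comp h).contDiffOn, fun _ _ => rfl⟩

variable {𝕜 U I}

open Classical in
/-- Extension by zero from `U`. -/
def extZero (f : U → (JetIndex n I → ℝ) → 𝕜) (x : Fin n → ℝ) (u : JetIndex n I → ℝ) : 𝕜 :=
  if h : x ∈ U then f ⟨x, h⟩ u else 0

/-- The partial derivative of a function of `(x, [u])` in the constant direction `(ξ, v)`. -/
def dirDeriv (ξ : Fin n → ℝ) (v : JetIndex n I → ℝ) (f : U → (JetIndex n I → ℝ) → 𝕜) :
    U → (JetIndex n I → ℝ) → 𝕜 :=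
  fun x u => deriv (fun t : ℝ => extZero f (x + t • ξ) (u + t • v)) 0

theorem hasDerivAt_dirDeriv (ξ : Fin n → ℝ) (v : JetIndex n I → ℝ)
    {f : U → (JetIndex n I → ℝ) → 𝕜} {S : Finset (JetIndex n I)}
    {g : (Fin n → ℝ) × (S → ℝ) → 𝕜}
    (hg : ContDiffOn ℝ ∞ g ((U : Set (Fin n → ℝ)) ×ˢ Set.univ))
    (e : ∀ x u, f x u = g (x, fun s => u s)) (x : U) (u : JetIndex n I → ℝ) :
    HasDerivAt (fun t : ℝ => extZero f (x + t • ξ) (u + t • v))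
      (fderiv ℝ g (x, fun s => u s) (ξ, fun s => v s)) 0 := by
  have hU : IsOpen ((U : Set (Fin n → ℝ)) ×ˢ (Set.univ : Set (S → ℝ))) :=
    U.isOpen.prod isOpen_univ
  have hd : HasFDerivAt g (fderiv ℝ g (x, fun s => u s)) (x, fun s : S => u s) :=
    ((hg.contDiffAt (hU.mem_nhds ⟨x.2, trivial⟩)).differentiableAt (by simp)).hasFDerivAt
  have hc : HasDerivAt (fun t : ℝ => (((x : Fin n → ℝ) + t • ξ, fun s : S => u s + t * v s) :
      (Fin n → ℝ) × (S → ℝ))) (ξ, fun s => v s) 0 := by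
    refine HasDerivAt.prodMk ?_ ?_
    · simpa using ((hasDerivAt_id (0 : ℝ)).smul_const ξ).const_add (x : Fin n → ℝ)
    · rw [hasDerivAt_pi]
      intro s
      simpa using ((hasDerivAt_id (0 : ℝ)).mul_const (v s)).const_add (u s)
  have h0 : (((x : Fin n → ℝ) + (0 : ℝ) • ξ, fun s : S => u s + 0 * v s) :
      (Fin n → ℝ) × (S → ℝ)) = ((x : Fin n → ℝ), fun s : S => u s) := by simp
  rw [← h0] at hd
  have hcomp := hd.comp_hasDerivAt (0 : ℝ) hc
  rw [h0] at hcomp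
  refine hcomp.congr_of_eventuallyEq ?_
  have hcont : Filter.Tendsto (fun t : ℝ => (x : Fin n → ℝ) + t • ξ) (nhds 0) (nhds x) := by
    have : Continuous (fun t : ℝ => (x : Fin n → ℝ) + t • ξ) := by fun_prop
    simpa using this.tendsto 0
  filter_upwards [hcont (U.isOpen.mem_nhds x.2)] with t ht
  have ht' : (x : Fin n → ℝ) + t • ξ ∈ U := ht
  simp only [extZero, dif_pos ht', e]
  rfl

theorem dirDeriv_eq (ξ : Fin n → ℝ) (v : JetIndex n I → ℝ)
    {f : U → (JetIndex n I → ℝ) → 𝕜} {S : Finset (JetIndex n I)}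
    {g : (Fin n → ℝ) × (S → ℝ) → 𝕜}
    (hg : ContDiffOn ℝ ∞ g ((U : Set (Fin n → ℝ)) ×ˢ Set.univ))
    (e : ∀ x u, f x u = g (x, fun s => u s)) (x : U) (u : JetIndex n I → ℝ) :
    dirDeriv ξ v f x u = fderiv ℝ g (x, fun s => u s) (ξ, fun s => v s) :=
  (hasDerivAt_dirDeriv ξ v hg e x u).deriv

theorem IsDiffFun.dirDeriv (ξ : Fin n → ℝ) (v : JetIndex n I → ℝ)
    {f : U → (JetIndex n I → ℝ) → 𝕜} (hf : IsDiffFun 𝕜 U I f) :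
    IsDiffFun 𝕜 U I (dirDeriv ξ v f) := by
  obtain ⟨S, g, hg, e⟩ := hf
  have hU : IsOpen ((U : Set (Fin n → ℝ)) ×ˢ (Set.univ : Set (S → ℝ))) :=
    U.isOpen.prod isOpen_univ
  exact ⟨S, fun p => fderiv ℝ g p (ξ, fun s => v s),
    (hg.fderiv_of_isOpen hU (m := ∞) (by simp)).clm_apply contDiffOn_const,
    fun x u => dirDeriv_eq ξ v hg e x u⟩

/-- The partial derivative in a constant direction, on the space of differential functions. -/
def DiffFun.dir (ξ : Fin n → ℝ) (v : JetIndex n I → ℝ) : DiffFun 𝕜 U I →ₗ[𝕜] DiffFun 𝕜 U I where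
  toFun f := ⟨dirDeriv ξ v f.1, IsDiffFun.dirDeriv ξ v f.2⟩
  map_add' f₁ f₂ := by
    obtain ⟨S, g₁, g₂, ⟨h₁, e₁⟩, h₂, e₂⟩ := IsDiffFun.common f₁.2 f₂.2
    refine Subtype.ext (funext fun x => funext fun u => ?_)
    have a₁ := hasDerivAt_dirDeriv ξ v h₁ e₁ x u
    have a₂ := hasDerivAt_dirDeriv ξ v h₂ e₂ x u
    change deriv (fun t : ℝ => extZero (f₁.1 + f₂.1) (x + t • ξ) (u + t • v)) 0 =
      deriv (fun t : ℝ => extZero f₁.1 (x + t • ξ) (u + t • v)) 0 +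
        deriv (fun t : ℝ => extZero f₂.1 (x + t • ξ) (u + t • v)) 0
    rw [a₁.deriv, a₂.deriv, ← (a₁.add a₂).deriv]
    congr 1
    funext t
    simp only [extZero, Pi.add_apply]
    split_ifs <;> simp
  map_smul' c f := by
    obtain ⟨S, g, h, e⟩ := f.2
    refine Subtype.ext (funext fun x => funext fun u => ?_)
    have a := hasDerivAt_dirDeriv ξ v h e x u
    change deriv (fun t : ℝ => extZero (c • f.1) (x + t • ξ) (u + t • v)) 0 =
      c * deriv (fun t : ℝ => extZero f.1 (x + t • ξ) (u + t • v)) 0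
    rw [a.deriv, ← (a.const_mul c).deriv]
    congr 1
    funext t
    simp only [extZero]
    split_ifs <;> simp

/-- The partial derivative `∂/∂x^k` at fixed jet coordinates. -/
def DiffFun.pdX (k : Fin n) : DiffFun 𝕜 U I →ₗ[𝕜] DiffFun 𝕜 U I := DiffFun.dir (Pi.single k 1) 0

open Classical in
/-- The partial derivative `∂/∂u_s` along a jet coordinate. -/
def DiffFun.pdU (s : JetIndex n I) : DiffFun 𝕜 U I →ₗ[𝕜] DiffFun 𝕜 U I :=
  DiffFun.dir 0 (Pi.single s 1)

theorem DiffFun.pdU_finite (f : DiffFun 𝕜 U I) :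
    {s : JetIndex n I | DiffFun.pdU s f ≠ 0}.Finite := by
  classical
  obtain ⟨S, g, h, e⟩ := f.2
  refine S.finite_toSet.subset fun s hs => ?_
  by_contra hsS
  refine hs (Subtype.ext (funext fun x => funext fun u => ?_))
  change dirDeriv _ _ f.1 x u = 0
  rw [dirDeriv_eq _ _ h e]
  have : (fun r : S => (Pi.single s (1 : ℝ) : JetIndex n I → ℝ) r) = 0 := by
    funext r
    have hr : (r : JetIndex n I) ≠ s := fun hr => hsS (hr ▸ r.2)
    simp [hr]
  have h2 : ((0 : Fin n → ℝ), fun r : S => (Pi.single s (1 : ℝ) : JetIndex n I → ℝ) r) = 0 := by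
    rw [this]; rfl
  convert map_zero (fderiv ℝ g (x, fun s => u s))

end Jets

section Pack

variable {𝕜 : Type*} [Field 𝕜] {K A B C : Type*} [AddCommGroup A] [Module 𝕜 A] [AddCommGroup B]
  [Module 𝕜 B] [AddCommGroup C] [Module 𝕜 C]

/-- A pointwise finite family of linear maps, as one map to finitely supported families. -/
def pack (D : K → A →ₗ[𝕜] B) (h : ∀ a, {k | D k a ≠ 0}.Finite) : A →ₗ[𝕜] (K →₀ B) where
  toFun a := Finsupp.ofSupportFinite (fun k => D k a) (h a)
  map_add' a b := Finsupp.ext fun k => map_add (D k) a b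
  map_smul' c a := Finsupp.ext fun k => map_smul (D k) c a

theorem pack_apply (D : K → A →ₗ[𝕜] B) (h : ∀ a, {k | D k a ≠ 0}.Finite) (a : A) (k : K) :
    pack D h a k = D k a := rfl

/-- The sum `∑_k f_k ∘ D_k` over a pointwise finite family `D`. -/
def packSum (f : K → B →ₗ[𝕜] C) (D : K → A →ₗ[𝕜] B) (h : ∀ a, {k | D k a ≠ 0}.Finite) :
    A →ₗ[𝕜] C := Finsupp.lsum 𝕜 f ∘ₗ pack D h

theorem packSum_apply (f : K → B →ₗ[𝕜] C) (D : K → A →ₗ[𝕜] B)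
    (h : ∀ a, {k | D k a ≠ 0}.Finite) (a : A) : packSum f D h a = ∑ᶠ k, f k (D k a) := by
  rw [packSum, LinearMap.comp_apply, Finsupp.lsum_apply, Finsupp.sum,
    finsum_eq_sum_of_support_subset]
  · rfl
  · intro k hk
    rw [Finset.mem_coe, Finsupp.mem_support_iff]
    intro h0
    exact hk (by change f k (D k a) = 0; rw [← pack_apply D h, h0, map_zero])

theorem packSum_comm {f : K → B →ₗ[𝕜] C} {D : K → A →ₗ[𝕜] B}
    (h : ∀ a, {k | D k a ≠ 0}.Finite) (Q : A →ₗ[𝕜] A) (Q' : C →ₗ[𝕜] C)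
    (hc : ∀ k a, Q' (f k (D k a)) = f k (D k (Q a))) (a : A) :
    Q' (packSum f D h a) = packSum f D h (Q a) := by
  rw [packSum_apply, packSum_apply, ← LinearMap.toAddMonoidHom_coe, AddMonoidHom.map_finsum]
  · exact finsum_congr fun k => hc k a
  · refine (h a).subset fun k hk => ?_
    intro h0
    exact hk (by change f k (D k a) = 0; rw [h0, map_zero])

end Pack

section TensorOps

variable {𝕜 : Type*} [Field 𝕜] {R W K : Type*} [CommRing R] [Algebra 𝕜 R] [Ring W] [Algebra 𝕜 W]
  {Q : Parity 𝕜 W}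

theorem rTensor_finite (d : K → R →ₗ[𝕜] R) (h : ∀ r, {k | d k r ≠ 0}.Finite) (a : R ⊗[𝕜] W) :
    {k | LinearMap.rTensor W (d k) a ≠ 0}.Finite := by
  induction a using TensorProduct.induction_on with
  | zero => simp
  | add x y hx hy =>
    refine (hx.union hy).subset fun s hs => ?_
    by_contra h
    simp only [Set.mem_union, Set.mem_ofPred_eq, not_or, not_not] at h
    exact hs (by rw [map_add, h.1, h.2, add_zero])
  | tmul f x =>
    exact (h f).subset fun s hs h0 =>
      hs (by rw [LinearMap.rTensor_tmul, h0, TensorProduct.zero_tmul])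

theorem lTensor_finite (d : K → W →ₗ[𝕜] W) (h : ∀ r, {k | d k r ≠ 0}.Finite) (a : R ⊗[𝕜] W) :
    {k | LinearMap.lTensor R (d k) a ≠ 0}.Finite := by
  induction a using TensorProduct.induction_on with
  | zero => simp
  | add x y hx hy =>
    refine (hx.union hy).subset fun s hs => ?_
    by_contra h
    simp only [Set.mem_union, Set.mem_ofPred_eq, not_or, not_not] at h
    exact hs (by rw [map_add, h.1, h.2, add_zero])
  | tmul f x =>
    exact (h x).subset fun s hs h0 =>
      hs (by rw [LinearMap.lTensor_tmul, h0, TensorProduct.tmul_zero])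

theorem tensorPar_rTensor (d : R →ₗ[𝕜] R) (a : R ⊗[𝕜] W) :
    (tensorPar R Q).op (LinearMap.rTensor W d a) =
      LinearMap.rTensor W d ((tensorPar R Q).op a) := by
  induction a using TensorProduct.induction_on with
  | zero => simp
  | add x y hx hy => simp only [map_add, hx, hy]
  | tmul f x => rfl

theorem tensorPar_lTensor_even (d : W →ₗ[𝕜] W) (hd : ∀ x, Q.op (d x) = d (Q.op x))
    (a : R ⊗[𝕜] W) :
    (tensorPar R Q).op (LinearMap.lTensor R d a) =
      LinearMap.lTensor R d ((tensorPar R Q).op a) := by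
  induction a using TensorProduct.induction_on with
  | zero => simp
  | add x y hx hy => simp only [map_add, hx, hy]
  | tmul f x => simp [tensorPar, hd]

theorem tensorPar_lTensor_odd (d : W →ₗ[𝕜] W) (hd : ∀ x, Q.op (d x) = -d (Q.op x))
    (a : R ⊗[𝕜] W) :
    (tensorPar R Q).op (LinearMap.lTensor R d a) =
      -LinearMap.lTensor R d ((tensorPar R Q).op a) := by
  induction a using TensorProduct.induction_on with
  | zero => simp
  | add x y hx hy => simp only [map_add, hx, hy, neg_add]
  | tmul f x => simp [tensorPar, hd, TensorProduct.tmul_neg]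

theorem packSum_even {A : Type*} [Ring A] [Algebra 𝕜 A] {P : Parity 𝕜 A}
    (hP : ∀ x y, P.op (x * y) = P.op x * P.op y) {c : K → A} {D : K → A →ₗ[𝕜] A}
    (h : ∀ a, {k | D k a ≠ 0}.Finite) (hc : ∀ k, P.op (c k) = c k)
    (hD : ∀ k a, P.op (D k a) = D k (P.op a)) (a : A) :
    P.op (packSum (fun k => LinearMap.mulLeft 𝕜 (c k)) D h a) =
      packSum (fun k => LinearMap.mulLeft 𝕜 (c k)) D h (P.op a) :=
  packSum_comm h P.op P.op (fun k b => by
    rw [LinearMap.mulLeft_apply, LinearMap.mulLeft_apply, hP, hc, hD]) a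

theorem packSum_odd {A : Type*} [Ring A] [Algebra 𝕜 A] {P : Parity 𝕜 A}
    (hP : ∀ x y, P.op (x * y) = P.op x * P.op y) {c : K → A} {D : K → A →ₗ[𝕜] A}
    (h : ∀ a, {k | D k a ≠ 0}.Finite) (hc : ∀ k, P.op (c k) = -c k)
    (hD : ∀ k a, P.op (D k a) = -D k (P.op a)) (a : A) :
    P.op (packSum (fun k => LinearMap.mulLeft 𝕜 (c k)) D h a) =
      packSum (fun k => LinearMap.mulLeft 𝕜 (c k)) D h (P.op a) :=
  packSum_comm h P.op P.op (fun k b => by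
    rw [LinearMap.mulLeft_apply, LinearMap.mulLeft_apply, hP, hc, hD, neg_mul_neg]) a

theorem Parity.prod_comm {A : Type*} [AddCommGroup A] [Module 𝕜 A] (P : Parity 𝕜 A) {n : ℕ}
    (D : Fin n → Module.End 𝕜 A) (hD : ∀ k a, P.op (D k a) = D k (P.op a)) (σ : Fin n → ℕ)
    (a : A) : P.op ((List.ofFn fun k => D k ^ σ k).prod a) =
      (List.ofFn fun k => D k ^ σ k).prod (P.op a) := by
  suffices h : Commute (P.op : Module.End 𝕜 A) (List.ofFn fun k => D k ^ σ k).prod from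
    LinearMap.congr_fun h a
  refine Commute.list_prod_right _ _ fun E hE => ?_
  obtain ⟨k, rfl⟩ := List.mem_ofFn.1 hE
  exact Commute.pow_right (LinearMap.ext (hD k)) _

end TensorOps

section GrassmannAlgebra

variable (𝕜 : Type*) [Field 𝕜] (J : Type*)

/-- The Grassmann algebra generated by the parity-odd variables labelled by `J`. -/
abbrev Grassmann : Type _ := ExteriorAlgebra 𝕜 (J →₀ 𝕜)

variable {𝕜 J}

namespace Grassmann

/-- The odd coordinate `q†_s`. -/
def coord (s : J) : Grassmann 𝕜 J := ExteriorAlgebra.ι 𝕜 (Finsupp.single s 1)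

variable (𝕜 J) in
/-- The ghost parity on the Grassmann algebra. -/
def par : Parity 𝕜 (Grassmann 𝕜 J) :=
  ⟨CliffordAlgebra.involute.toLinearMap, CliffordAlgebra.involute_involute⟩

theorem par_mul (x y : Grassmann 𝕜 J) :
    (par 𝕜 J).op (x * y) = (par 𝕜 J).op x * (par 𝕜 J).op y :=
  map_mul CliffordAlgebra.involute x y

theorem par_ι (v : J →₀ 𝕜) :
    (par 𝕜 J).op (ExteriorAlgebra.ι 𝕜 v) = -ExteriorAlgebra.ι 𝕜 v :=
  CliffordAlgebra.involute_ι v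

theorem par_one : (par 𝕜 J).op 1 = 1 := map_one CliffordAlgebra.involute

theorem par_algebraMap (r : 𝕜) :
    (par 𝕜 J).op (algebraMap 𝕜 _ r) = algebraMap 𝕜 _ r :=
  CliffordAlgebra.involute.commutes r

theorem ι_mul (v : J →₀ 𝕜) (x : Grassmann 𝕜 J) :
    ExteriorAlgebra.ι 𝕜 v * x = (par 𝕜 J).op x * ExteriorAlgebra.ι 𝕜 v := by
  induction x using ExteriorAlgebra.induction with
  | algebraMap r => rw [par_algebraMap]; exact (Algebra.commutes r _).symm
  | ι w =>
    rw [par_ι, neg_mul, eq_neg_iff_add_eq_zero]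
    exact ExteriorAlgebra.ι_add_mul_swap v w
  | mul x y hx hy => rw [← mul_assoc, hx, mul_assoc, hy, par_mul, mul_assoc]
  | add x y hx hy => rw [mul_add, map_add, add_mul, hx, hy]

theorem superComm : SuperComm (par 𝕜 J) := by
  intro x y
  constructor
  · intro hx
    induction y using ExteriorAlgebra.induction with
    | algebraMap r => exact Algebra.commutes r _
    | ι v => rw [ι_mul, hx]
    | mul y z hy hz => rw [mul_assoc, hz, ← mul_assoc, hy, mul_assoc]
    | add y z hy hz => rw [mul_add, add_mul, hy, hz]
  · intro hx
    induction y using ExteriorAlgebra.induction with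
    | algebraMap r => rw [par_algebraMap]; exact Algebra.commutes r _
    | ι v => rw [ι_mul, hx, par_ι, neg_mul, mul_neg]
    | mul y z hy hz => rw [mul_assoc, hz, ← mul_assoc, hy, mul_assoc, par_mul]
    | add y z hy hz => rw [map_add, mul_add, add_mul, hy, hz]

/-- The left derivative `∂/∂q†_s`. -/
def pd (s : J) : Grassmann 𝕜 J →ₗ[𝕜] Grassmann 𝕜 J :=
  CliffordAlgebra.contractLeft (Finsupp.lapply s)

theorem pd_ι_mul (s : J) (v : J →₀ 𝕜) (x : Grassmann 𝕜 J) :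
    pd s (ExteriorAlgebra.ι 𝕜 v * x) = v s • x - ExteriorAlgebra.ι 𝕜 v * pd s x :=
  CliffordAlgebra.contractLeft_ι_mul _ _ _

theorem pd_one (s : J) : pd s (1 : Grassmann 𝕜 J) = 0 :=
  CliffordAlgebra.contractLeft_one (Q := (0 : QuadraticForm 𝕜 (J →₀ 𝕜))) _

theorem inductionLeft {C : Grassmann 𝕜 J → Prop} (h1 : C 1) (hsmul : ∀ (r : 𝕜) x, C x → C (r • x))
    (hadd : ∀ x y, C x → C y → C (x + y))
    (hmul : ∀ v x, C x → C (ExteriorAlgebra.ι 𝕜 v * x)) (x : Grassmann 𝕜 J) : C x := by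
  have key : ∀ y, C y → C (x * y) := by
    induction x using ExteriorAlgebra.induction with
    | algebraMap r => intro y hy; rw [← Algebra.smul_def]; exact hsmul r y hy
    | ι v => exact fun y hy => hmul v y hy
    | mul a b ha hb => intro y hy; rw [mul_assoc]; exact ha _ (hb _ hy)
    | add a b ha hb => intro y hy; rw [add_mul]; exact hadd _ _ (ha _ hy) (hb _ hy)
  simpa using key 1 h1

theorem par_pd (s : J) (x : Grassmann 𝕜 J) :
    (par 𝕜 J).op (pd s x) = -pd s ((par 𝕜 J).op x) := by
  induction x using inductionLeft with
  | h1 =>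
    rw [par_one, pd_one, map_zero, neg_zero]
  | hsmul r x hx => simp only [map_smul, hx, smul_neg]
  | hadd x y hx hy => simp only [map_add, hx, hy, neg_add]
  | hmul v x hx =>
    rw [pd_ι_mul, map_sub, map_smul, par_mul, par_mul, par_ι, hx, neg_mul, neg_mul, map_neg,
      pd_ι_mul, neg_neg, mul_neg, neg_neg]

theorem pd_finite (x : Grassmann 𝕜 J) : {s | pd s x ≠ 0}.Finite := by
  induction x using inductionLeft with
  | h1 => simp [pd_one]
  | hsmul r x hx => exact hx.subset fun s hs h0 => hs (by rw [map_smul, h0, smul_zero])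
  | hadd x y hx hy =>
    refine (hx.union hy).subset fun s hs => ?_
    by_contra h
    simp only [Set.mem_union, Set.mem_ofPred_eq, not_or, not_not] at h
    exact hs (by rw [map_add, h.1, h.2, add_zero])
  | hmul v x hx =>
    refine (hx.union v.support.finite_toSet).subset fun s hs => ?_
    by_contra h
    simp only [Set.mem_union, Set.mem_ofPred_eq, not_or, not_not, Finset.mem_coe,
      Finsupp.mem_support_iff] at h
    exact hs (by rw [pd_ι_mul, h.1, h.2, zero_smul, mul_zero, sub_zero])

end Grassmann

end GrassmannAlgebra

section Densities

variable (𝕜 : Type) [RCLike 𝕜] {n : ℕ} (U : TopologicalSpace.Opens (Fin n → ℝ)) (m N : ℕ)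

/-- Polynomials in the parity-odd jet coordinates `q†_{i,σ}`. -/
def OddAlg (n N : ℕ) : Type := Grassmann 𝕜 (JetIndex n (Fin N))

instance (n N : ℕ) : Ring (OddAlg 𝕜 n N) := inferInstanceAs (Ring (Grassmann 𝕜 _))
instance (n N : ℕ) : Algebra 𝕜 (OddAlg 𝕜 n N) := inferInstanceAs (Algebra 𝕜 (Grassmann 𝕜 _))

/-- Densities `f(x, [φ], [q], [q†])`: differential functions of the `m` physical fields `φ` and of
the `N` parity-even BV-variables `q`, tensored with polynomials in the parity-odd variables. -/
def Density : Type := DiffFun 𝕜 U (Fin m ⊕ Fin N) ⊗[𝕜] OddAlg 𝕜 n N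

instance : Ring (Density 𝕜 U m N) :=
  inferInstanceAs (Ring (DiffFun 𝕜 U (Fin m ⊕ Fin N) ⊗[𝕜] OddAlg 𝕜 n N))
instance : Algebra 𝕜 (Density 𝕜 U m N) :=
  inferInstanceAs (Algebra 𝕜 (DiffFun 𝕜 U (Fin m ⊕ Fin N) ⊗[𝕜] OddAlg 𝕜 n N))

variable {𝕜 N}

namespace OddAlg

/-- The odd coordinate `q†_s`. -/
def coord (s : JetIndex n (Fin N)) : OddAlg 𝕜 n N := Grassmann.coord s

variable (𝕜 n N) in
/-- The ghost parity. -/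
def par : Parity 𝕜 (OddAlg 𝕜 n N) := Grassmann.par 𝕜 _

/-- The left derivative `∂/∂q†_s`. -/
def pd (s : JetIndex n (Fin N)) : OddAlg 𝕜 n N →ₗ[𝕜] OddAlg 𝕜 n N := Grassmann.pd s

theorem par_mul (x y : OddAlg 𝕜 n N) :
    (par 𝕜 n N).op (x * y) = (par 𝕜 n N).op x * (par 𝕜 n N).op y := Grassmann.par_mul x y

theorem par_one : (par 𝕜 n N).op 1 = 1 := Grassmann.par_one

theorem par_coord (s : JetIndex n (Fin N)) :
    (par 𝕜 n N).op (coord s) = -coord s := Grassmann.par_ι _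

theorem superComm : SuperComm (par 𝕜 n N) := Grassmann.superComm

theorem par_pd (s : JetIndex n (Fin N)) (x : OddAlg 𝕜 n N) :
    (par 𝕜 n N).op (pd s x) = -pd s ((par 𝕜 n N).op x) := Grassmann.par_pd s x

theorem pd_finite (x : OddAlg 𝕜 n N) : {s | pd s x ≠ 0}.Finite := Grassmann.pd_finite x

end OddAlg

variable (𝕜 N)

namespace Density

/-- The ghost parity of densities. -/
def par : Parity 𝕜 (Density 𝕜 U m N) := tensorPar _ (OddAlg.par 𝕜 n N)

theorem superComm : SuperComm (par 𝕜 U m N) := tensorPar_superComm OddAlg.superComm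

variable {𝕜 U m N}

/-- `∂/∂u_s` along a parity-even jet coordinate. -/
def pdEven (s : JetIndex n (Fin m ⊕ Fin N)) : Density 𝕜 U m N →ₗ[𝕜] Density 𝕜 U m N :=
  LinearMap.rTensor _ (DiffFun.pdU s)

/-- `∂/∂q†_s` along a parity-odd jet coordinate, acting from the left. -/
def pdOdd (s : JetIndex n (Fin N)) : Density 𝕜 U m N →ₗ[𝕜] Density 𝕜 U m N :=
  LinearMap.lTensor _ (OddAlg.pd s)

theorem pdEven_finite (a : Density 𝕜 U m N) : {s | pdEven s a ≠ 0}.Finite :=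
  rTensor_finite _ DiffFun.pdU_finite a

theorem pdOdd_finite (a : Density 𝕜 U m N) : {s | pdOdd s a ≠ 0}.Finite :=
  lTensor_finite _ OddAlg.pd_finite a

theorem par_pdEven (s : JetIndex n (Fin m ⊕ Fin N)) (a : Density 𝕜 U m N) :
    (par 𝕜 U m N).op (pdEven s a) = pdEven s ((par 𝕜 U m N).op a) :=
  tensorPar_rTensor _ a

theorem par_pdOdd (s : JetIndex n (Fin N)) (a : Density 𝕜 U m N) :
    (par 𝕜 U m N).op (pdOdd s a) = -pdOdd s ((par 𝕜 U m N).op a) :=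
  tensorPar_lTensor_odd _ (OddAlg.par_pd s) a

theorem par_mul (a b : Density 𝕜 U m N) :
    (par 𝕜 U m N).op (a * b) = (par 𝕜 U m N).op a * (par 𝕜 U m N).op b :=
  tensorPar_mul OddAlg.par_mul a b

/-- A differential function of the parity-even variables as a density. -/
def ofEven : DiffFun 𝕜 U (Fin m ⊕ Fin N) →ₐ[𝕜] Density 𝕜 U m N :=
  Algebra.TensorProduct.includeLeft (B := OddAlg 𝕜 n N)

/-- A polynomial in the parity-odd variables as a density. -/
def ofOdd (x : OddAlg 𝕜 n N) : Density 𝕜 U m N := (1 : DiffFun 𝕜 U (Fin m ⊕ Fin N)) ⊗ₜ[𝕜] x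

theorem par_ofEven (f : DiffFun 𝕜 U (Fin m ⊕ Fin N)) :
    (par 𝕜 U m N).op (ofEven f) = ofEven f := by
  change f ⊗ₜ[𝕜] (OddAlg.par 𝕜 n N).op 1 = _
  rw [OddAlg.par_one]
  rfl

theorem par_ofOdd_coord (s : JetIndex n (Fin N)) :
    (par 𝕜 U m N).op (ofOdd (OddAlg.coord s)) = -ofOdd (OddAlg.coord s) := by
  change (1 : DiffFun 𝕜 U (Fin m ⊕ Fin N)) ⊗ₜ[𝕜] (OddAlg.par 𝕜 n N).op (OddAlg.coord s) = _
  rw [OddAlg.par_coord, TensorProduct.tmul_neg]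
  rfl

theorem par_one : (par 𝕜 U m N).op 1 = 1 := by
  rw [← map_one ofEven, par_ofEven]

/-- The partial derivative `∂/∂x^k` at fixed jet coordinates. -/
def pdX (k : Fin n) : Density 𝕜 U m N →ₗ[𝕜] Density 𝕜 U m N :=
  LinearMap.rTensor _ (DiffFun.pdX k)

/-- The total derivative
`d/dx^k = ∂/∂x^k + ∑_s u_{s+1_k} ∂/∂u_s + ∑_s q†_{s+1_k} ∂/∂q†_s`. -/
def totalD (k : Fin n) : Density 𝕜 U m N →ₗ[𝕜] Density 𝕜 U m N :=
  pdX k +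
    packSum (fun s => LinearMap.mulLeft 𝕜 (ofEven (DiffFun.coord 𝕜 U _ (s.shift k))))
      pdEven pdEven_finite +
    packSum (fun s => LinearMap.mulLeft 𝕜 (ofOdd (OddAlg.coord (s.shift k))))
      pdOdd pdOdd_finite

theorem par_totalD (k : Fin n) (a : Density 𝕜 U m N) :
    (par 𝕜 U m N).op (totalD k a) = totalD k ((par 𝕜 U m N).op a) := by
  rw [totalD, LinearMap.add_apply, LinearMap.add_apply, LinearMap.add_apply, LinearMap.add_apply,
    map_add, map_add, packSum_even par_mul pdEven_finite (fun s => par_ofEven _) par_pdEven,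
    packSum_odd par_mul pdOdd_finite (fun s => par_ofOdd_coord _) par_pdOdd]
  congr 2
  exact tensorPar_rTensor _ a

/-- The iterated total derivative `(d/dx)^σ`. -/
def totalDMulti (σ : MultiIndex n) : Module.End 𝕜 (Density 𝕜 U m N) :=
  (List.ofFn fun k => (totalD k : Module.End 𝕜 (Density 𝕜 U m N)) ^ σ k).prod

theorem par_totalDMulti (σ : MultiIndex n) (a : Density 𝕜 U m N) :
    (par 𝕜 U m N).op (totalDMulti σ a) = totalDMulti σ ((par 𝕜 U m N).op a) :=
  (par 𝕜 U m N).prod_comm _ par_totalD σ a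

end Density

end Densities

section Ops

variable {𝕜 : Type*} [Field 𝕜] {V : Type*} [AddCommGroup V] [Module 𝕜 V]

/-- A BV-Laplacian and a Schouten bracket on a space of single integral functionals, with the
symmetry properties that make their extension to products unambiguous. -/
structure BlockOps (P : Parity 𝕜 V) where
  lap : V →ₗ[𝕜] V
  br : V →ₗ[𝕜] V →ₗ[𝕜] V
  par_lap : ∀ a, P.op (lap a) = -lap (P.op a)
  par_br : ∀ a b, P.op (br a b) = -br (P.op a) (P.op b)
  br_even : ∀ a b, P.op a = a → br a b = br (P.op b) a
  br_odd : ∀ a b, P.op a = -a → P.op b = -b → br a b = -br b a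

section OfDerivations

variable {B : Type*} [Ring B] [Algebra 𝕜 B] {P : Parity 𝕜 B} {ι : Type*} [Fintype ι]

/-- `∑_i w_i · δ_i δ†_i a`. -/
def lapOf (w : ι → B) (δ δd : ι → B →ₗ[𝕜] B) : B →ₗ[𝕜] B :=
  ∑ i, LinearMap.mulLeft 𝕜 (w i) ∘ₗ δ i ∘ₗ δd i

/-- `∑_i w_i · (δ_i a · δ†_i b + δ†_i (ε a) · δ_i b)`, where `ε` is the parity involution. Since
the right derivative along the odd variables is `∂†ᴿ_i a = (-1)^{|a| - 1} δ†_i a = -δ†_i (ε a)`, this is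
`∑_i w_i · (δ_i a · δ†_i b - ∂†ᴿ_i a · δ_i b)`. -/
def brOf (P : Parity 𝕜 B) (w : ι → B) (δ δd : ι → B →ₗ[𝕜] B) : B →ₗ[𝕜] B →ₗ[𝕜] B :=
  ∑ i, ((LinearMap.mul 𝕜 B).compl₁₂ (δ i) (δd i) +
    (LinearMap.mul 𝕜 B).compl₁₂ (δd i ∘ₗ P.op) (δ i)).compr₂ (LinearMap.mulLeft 𝕜 (w i))

theorem lapOf_apply (w : ι → B) (δ δd : ι → B →ₗ[𝕜] B) (a : B) :
    lapOf w δ δd a = ∑ i, w i * δ i (δd i a) := by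
  simp [lapOf]

theorem brOf_apply (w : ι → B) (δ δd : ι → B →ₗ[𝕜] B) (a b : B) :
    brOf P w δ δd a b = ∑ i, w i * (δ i a * δd i b + δd i (P.op a) * δ i b) := by
  simp [brOf, LinearMap.sum_apply]

/-- The operators built from even weights, even derivations `δ_i` and odd derivations `δ†_i` of a
graded-commutative algebra. -/
def BlockOps.ofDerivations (hP : SuperComm P) (hm : ∀ a b, P.op (a * b) = P.op a * P.op b)
    (w : ι → B) (δ δd : ι → B →ₗ[𝕜] B) (hw : ∀ i, P.op (w i) = w i)
    (hδ : ∀ i a, P.op (δ i a) = δ i (P.op a)) (hδd : ∀ i a, P.op (δd i a) = -δd i (P.op a)) :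
    BlockOps P where
  lap := lapOf w δ δd
  br := brOf P w δ δd
  par_lap a := by
    simp only [lapOf_apply, map_sum, hm, hw, hδ, hδd, map_neg, mul_neg, Finset.sum_neg_distrib]
  par_br a b := by
    simp only [brOf_apply, map_sum, map_add, hm, hw, hδ, hδd, mul_neg, neg_mul, mul_add, neg_add,
      Finset.sum_neg_distrib, Finset.sum_add_distrib]
  br_even a b ha := by
    simp only [brOf_apply]
    refine Finset.sum_congr rfl fun i _ => ?_
    have h1 : δd i b * δ i a = δ i a * δd i b := (hP _ _).1 (by rw [hδ, ha])
    have h2 : δ i (P.op b) * δd i a = δd i a * δ i b := by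
      rw [(hP (δd i a) _).2 (by rw [hδd, ha]), hδ, P.op_op]
    rw [ha, P.op_op, h1, h2, add_comm]
  br_odd a b ha hb := by
    simp only [brOf_apply, ← Finset.sum_neg_distrib]
    refine Finset.sum_congr rfl fun i _ => ?_
    have h1 : δ i b * δd i a = δd i a * δ i b := (hP _ _).1 (by rw [hδd, ha, map_neg, neg_neg])
    have h2 : δd i b * δ i a = δ i a * δd i b :=
      ((hP _ _).1 (by rw [hδd, hb, map_neg, neg_neg])).symm
    rw [ha, hb, map_neg, map_neg, neg_mul, neg_mul, h1, h2, mul_add, mul_add, mul_neg, mul_neg]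
    abel

end OfDerivations

namespace BlockOps

open SuperSym

variable [CharZero 𝕜] {P : Parity 𝕜 V}

theorem swap (v w : V) :
    ι P v * ι P w = ι P (P.ev w) * ι P v + ι P (P.od w) * ι P (P.op v) := by
  conv_lhs => rw [← P.ev_add_od w, map_add, mul_add]
  rw [← ι_even (P.op_ev w) v, ι_mul_odd (P.op_od w), par_ι, P.op_op]

variable (O : BlockOps P)

/-- `c ↦ G ↦ (b ↦ ⟦b, c⟧ · G)`. -/
def innerα : V →ₗ[𝕜] SuperSym P →ₗ[𝕜] V →ₗ[𝕜] SuperSym P :=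
  LinearMap.mk₂ 𝕜 (fun c G => LinearMap.mulRight 𝕜 G ∘ₗ ι P ∘ₗ O.br.flip c)
    (fun c c' G => by ext b; simp [add_mul]) (fun r c G => by ext b; simp)
    (fun c G G' => by ext b; simp [mul_add]) (fun r c G => by ext b; simp)

variable (P) in
/-- `c ↦ T ↦ (b ↦ (-1)^{(|b| - 1)|c|} c · T b)`. -/
def innerβ : V →ₗ[𝕜] (V →ₗ[𝕜] SuperSym P) →ₗ[𝕜] V →ₗ[𝕜] SuperSym P :=
  LinearMap.mk₂ 𝕜 (fun c T => LinearMap.mulLeft 𝕜 (ι P (P.ev c)) ∘ₗ T -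
      LinearMap.mulLeft 𝕜 (ι P (P.od c)) ∘ₗ T ∘ₗ P.op)
    (fun c c' G => by ext b; simp [add_mul]; abel) (fun r c G => by ext b; simp [smul_sub])
    (fun c G G' => by ext b; simp [mul_add]; abel) (fun r c G => by ext b; simp [smul_sub])

theorem innerα_apply (c : V) (G : SuperSym P) (b : V) : O.innerα c G b = ι P (O.br b c) * G := rfl

theorem innerβ_apply (c : V) (T : V →ₗ[𝕜] SuperSym P) (b : V) :
    innerβ P c T b = ι P (P.ev c) * T b - ι P (P.od c) * T (P.op b) := rfl

theorem innerCompat : RecCompat O.innerα (innerβ P) where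
  even a b ha G H := by
    ext x
    obtain ⟨e1, e2⟩ := P.ev_even ha
    have h := swap (P := P) (O.br x a) b
    rw [O.par_br, ha, map_neg, mul_neg] at h
    have h1 := ι_even ha (P.ev b)
    have h2 := ι_even ha (P.od b)
    have h3 := ι_even ha (O.br x b)
    simp only [LinearMap.add_apply, innerα_apply, innerβ_apply, e1, e2, map_zero, zero_mul,
      sub_zero, mul_add, mul_sub, ← mul_assoc, h, h1, h2, h3, add_mul, neg_mul]
    abel
  odd a b ha hb G H := by
    ext x
    obtain ⟨e1, e2⟩ := P.ev_odd ha
    obtain ⟨f1, f2⟩ := P.ev_odd hb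
    have h := swap (P := P) (O.br x a) b
    rw [O.par_br, ha, f1, f2] at h
    simp only [map_neg, neg_neg, map_zero, zero_mul, zero_add] at h
    have h' := swap (P := P) (O.br x b) a
    rw [O.par_br, hb, e1, e2] at h'
    simp only [map_neg, neg_neg, map_zero, zero_mul, zero_add] at h'
    have h1 := ι_odd ha hb
    simp only [LinearMap.add_apply, LinearMap.neg_apply, innerα_apply, innerβ_apply, e1, e2, f1,
      f2, map_zero, zero_mul, zero_sub, mul_add, mul_neg, ← mul_assoc, h, h', h1, neg_mul, P.op_op,
      neg_add, neg_neg]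
    abel

/-- The bracket `⟦b, G⟧` of a single integral functional `b` with a formal sum of products `G`,
determined by `⟦b, 1⟧ = 0` and `⟦b, c · G⟧ = ⟦b, c⟧ · G + (-1)^{(|b| - 1)|c|} c · ⟦b, G⟧`. -/
def inner : SuperSym P →ₗ[𝕜] V →ₗ[𝕜] SuperSym P := recMap O.innerCompat

theorem inner_ι_mul (c : V) (G : SuperSym P) (b : V) :
    O.inner (ι P c * G) b =
      ι P (O.br b c) * G + (ι P (P.ev c) * O.inner G b - ι P (P.od c) * O.inner G (P.op b)) := by
  rw [inner, recMap_ι_mul]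
  rfl

/-- `b ↦ G ↦ (H ↦ (-1)^{|b||G|} G · ⟦b, H⟧)`. -/
def schoutenα : V →ₗ[𝕜] SuperSym P →ₗ[𝕜] SuperSym P →ₗ[𝕜] SuperSym P :=
  LinearMap.mk₂ 𝕜 (fun b G => LinearMap.mulLeft 𝕜 G ∘ₗ O.inner.flip (P.ev b) +
      LinearMap.mulLeft 𝕜 ((par P).op G) ∘ₗ O.inner.flip (P.od b))
    (fun c c' G => by ext b; simp [mul_add]; abel) (fun r c G => by ext b; simp)
    (fun c G G' => by ext b; simp [add_mul]; abel) (fun r c G => by ext b; simp)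

variable (P) in
/-- `b ↦ T ↦ (H ↦ b · T H)`. -/
def schoutenβ : V →ₗ[𝕜] (SuperSym P →ₗ[𝕜] SuperSym P) →ₗ[𝕜] SuperSym P →ₗ[𝕜] SuperSym P :=
  LinearMap.mk₂ 𝕜 (fun b T => LinearMap.mulLeft 𝕜 (ι P b) ∘ₗ T)
    (fun c c' G => by ext b; simp [add_mul]) (fun r c G => by ext b; simp)
    (fun c G G' => by ext b; simp [mul_add]) (fun r c G => by ext b; simp)

theorem schoutenα_apply (b : V) (G H : SuperSym P) :
    O.schoutenα b G H = G * O.inner H (P.ev b) + (par P).op G * O.inner H (P.od b) := rfl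

theorem schoutenβ_apply (b : V) (T : SuperSym P →ₗ[𝕜] SuperSym P) (H : SuperSym P) :
    schoutenβ P b T H = ι P b * T H := rfl

theorem schoutenCompat : RecCompat O.schoutenα (schoutenβ P) where
  even a b ha G T := by
    refine LinearMap.ext fun H => ?_
    obtain ⟨e1, e2⟩ := P.ev_even ha
    simp only [LinearMap.add_apply, schoutenα_apply, schoutenβ_apply, e1, e2, map_zero, mul_zero,
      add_zero, par_mul, par_ι, ha, mul_add, ← mul_assoc, ι_even ha b]
    abel
  odd a b ha hb G T := by
    refine LinearMap.ext fun H => ?_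
    obtain ⟨e1, e2⟩ := P.ev_odd ha
    obtain ⟨f1, f2⟩ := P.ev_odd hb
    simp only [LinearMap.add_apply, LinearMap.neg_apply, schoutenα_apply, schoutenβ_apply, e1, e2,
      f1, f2, map_zero, mul_zero, zero_add, par_mul, par_ι, ha, hb, map_neg, neg_mul, mul_add,
      ← mul_assoc, ι_odd ha hb, neg_add, neg_neg]
    abel

/-- The variational Schouten bracket of formal sums of products, determined by `⟦1, H⟧ = 0`, by
`inner` on single integral functionals and by
`⟦b · G, H⟧ = b · ⟦G, H⟧ + (-1)^{|G|(|H| - 1)} ⟦b, H⟧ · G`. -/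
def schouten : SuperSym P →ₗ[𝕜] SuperSym P →ₗ[𝕜] SuperSym P := recMap O.schoutenCompat

/-- `b ↦ G ↦ Δ b · G + (-1)^{|b|} ⟦b, G⟧`. -/
def lapα : V →ₗ[𝕜] SuperSym P →ₗ[𝕜] SuperSym P :=
  LinearMap.mul 𝕜 (SuperSym P) ∘ₗ ι P ∘ₗ O.lap + O.inner.flip ∘ₗ P.op

variable (P) in
/-- `b ↦ H ↦ (-1)^{|b|} b · H`. -/
def lapβ : V →ₗ[𝕜] SuperSym P →ₗ[𝕜] SuperSym P := LinearMap.mul 𝕜 (SuperSym P) ∘ₗ ι P ∘ₗ P.op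

theorem lapα_apply (b : V) (G : SuperSym P) :
    O.lapα b G = ι P (O.lap b) * G + O.inner G (P.op b) := rfl

theorem lapβ_apply (b : V) (G : SuperSym P) : lapβ P b G = ι P (P.op b) * G := rfl

theorem lapCompat : RecCompat O.lapα (lapβ P) where
  even a b ha G H := by
    obtain ⟨e1, e2⟩ := P.ev_even ha
    have h1 : P.op (O.lap a) = -O.lap a := by rw [O.par_lap, ha]
    have h2 : ι P (P.op b) = ι P (P.ev b) - ι P (P.od b) := by
      conv_lhs => rw [← P.ev_add_od b, map_add, P.op_ev, P.op_od, ← sub_eq_add_neg, map_sub]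
    simp only [lapα_apply, lapβ_apply, inner_ι_mul, ha, e1, e2, map_zero, zero_mul, sub_zero,
      O.br_even a b ha, ← sub_mul, ← h2, mul_add, ← mul_assoc, mul_ι_swap_odd h1 b,
      ι_even ha (O.lap b), ι_even ha (P.op b)]
    abel
  odd a b ha hb G H := by
    obtain ⟨e1, e2⟩ := P.ev_odd ha
    obtain ⟨f1, f2⟩ := P.ev_odd hb
    have h1 : P.op (O.lap a) = O.lap a := by rw [O.par_lap, ha, map_neg, neg_neg]
    have h2 : P.op (O.lap b) = O.lap b := by rw [O.par_lap, hb, map_neg, neg_neg]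
    simp only [lapα_apply, lapβ_apply, inner_ι_mul, ha, hb, e1, e2, f1, f2, map_zero, map_neg,
      zero_mul, zero_sub, neg_neg, O.br_odd a b ha hb, mul_add, ← mul_assoc, neg_mul, mul_neg,
      ι_even h1 b, ι_even h2 a, ι_odd ha hb, LinearMap.neg_apply]
    abel

/-- The BV-Laplacian on formal sums of products, determined by `Δ 1 = 0` and
`Δ (b · G) = Δ b · G + (-1)^{|b|} ⟦b, G⟧ + (-1)^{|b|} b · Δ G`. -/
def laplacian : SuperSym P →ₗ[𝕜] SuperSym P := recMap O.lapCompat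

end BlockOps

end Ops

section LegOps

variable {𝕜 : Type*} [Field 𝕜] {A : Type*} [AddCommGroup A] [Module 𝕜 A] {n : ℕ}

/-- The coefficientwise parity of polynomials in the deferred derivatives. -/
def legPar (n : ℕ) (P : Parity 𝕜 A) : Parity 𝕜 (MultiIndex n →₀ A) where
  op := Finsupp.mapRange.linearMap P.op
  op_op v := by ext σ; simp [P.op_op]

theorem sign_finite {D : MultiIndex n → A →ₗ[𝕜] A} (h : ∀ a, {τ | D τ a ≠ 0}.Finite) (a : A) :
    {τ : MultiIndex n | ((-1 : 𝕜) ^ τ.degree • D τ) a ≠ 0}.Finite :=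
  (h a).subset fun τ hτ h0 => hτ (by rw [LinearMap.smul_apply, h0, smul_zero])

/-- The operator `∑_τ (-p)^τ D_τ`: each `D_τ` acts on the coefficients and `p^τ` records the
total derivative `(d/dx)^τ` that is to be applied afterwards. -/
def legOp (D : MultiIndex n → A →ₗ[𝕜] A) (h : ∀ a, {τ | D τ a ≠ 0}.Finite) :
    (MultiIndex n →₀ A) →ₗ[𝕜] (MultiIndex n →₀ A) :=
  Finsupp.lsum 𝕜 fun σ => Finsupp.lmapDomain A 𝕜 (fun τ => σ + τ) ∘ₗ
    pack (fun τ => (-1 : 𝕜) ^ τ.degree • D τ) (sign_finite h)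

theorem legOp_single (D : MultiIndex n → A →ₗ[𝕜] A) (h : ∀ a, {τ | D τ a ≠ 0}.Finite)
    (σ : MultiIndex n) (a : A) : legOp D h (Finsupp.single σ a) =
      Finsupp.mapDomain (fun τ => σ + τ)
        (pack (fun τ => (-1 : 𝕜) ^ τ.degree • D τ) (sign_finite h) a) := by
  simp [legOp]

theorem legPar_single (P : Parity 𝕜 A) (σ : MultiIndex n) (a : A) :
    (legPar n P).op (Finsupp.single σ a) = Finsupp.single σ (P.op a) := by
  simp [legPar]

theorem legPar_mapDomain (P : Parity 𝕜 A) (f : MultiIndex n → MultiIndex n)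
    (x : MultiIndex n →₀ A) :
    (legPar n P).op (Finsupp.mapDomain f x) = Finsupp.mapDomain f ((legPar n P).op x) := by
  induction x using Finsupp.induction_linear with
  | zero => simp
  | add x y hx hy => simp only [Finsupp.mapDomain_add, map_add, hx, hy]
  | single σ a => simp only [Finsupp.mapDomain_single, legPar_single]

theorem legPar_legOp_even {P : Parity 𝕜 A} (D : MultiIndex n → A →ₗ[𝕜] A)
    (h : ∀ a, {τ | D τ a ≠ 0}.Finite) (hD : ∀ τ a, P.op (D τ a) = D τ (P.op a))
    (x : MultiIndex n →₀ A) :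
    (legPar n P).op (legOp D h x) = legOp D h ((legPar n P).op x) := by
  induction x using Finsupp.induction_linear with
  | zero => simp
  | add x y hx hy => simp only [map_add, hx, hy]
  | single σ a =>
    rw [legPar_single, legOp_single, legOp_single, legPar_mapDomain]
    congr 1
    ext τ
    change P.op (((-1 : 𝕜) ^ τ.degree • D τ) a) = ((-1 : 𝕜) ^ τ.degree • D τ) (P.op a)
    rw [LinearMap.smul_apply, LinearMap.smul_apply, map_smul, hD]

theorem legPar_legOp_odd {P : Parity 𝕜 A} (D : MultiIndex n → A →ₗ[𝕜] A)
    (h : ∀ a, {τ | D τ a ≠ 0}.Finite) (hD : ∀ τ a, P.op (D τ a) = -D τ (P.op a))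
    (x : MultiIndex n →₀ A) :
    (legPar n P).op (legOp D h x) = -legOp D h ((legPar n P).op x) := by
  induction x using Finsupp.induction_linear with
  | zero => simp
  | add x y hx hy => simp only [map_add, hx, hy, neg_add]
  | single σ a =>
    rw [legPar_single, legOp_single, legOp_single, legPar_mapDomain,
      ← Finsupp.mapDomain.addMonoidHom_apply, ← Finsupp.mapDomain.addMonoidHom_apply, ← map_neg]
    congr 1
    ext τ
    change P.op (((-1 : 𝕜) ^ τ.degree • D τ) a) = -(((-1 : 𝕜) ^ τ.degree • D τ) (P.op a))
    rw [LinearMap.smul_apply, LinearMap.smul_apply, map_smul, hD, smul_neg]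

theorem legPar_lsum {P : Parity 𝕜 A} (E : MultiIndex n → A →ₗ[𝕜] A)
    (hE : ∀ σ a, P.op (E σ a) = E σ (P.op a)) (x : MultiIndex n →₀ A) :
    P.op (Finsupp.lsum 𝕜 E x) = Finsupp.lsum 𝕜 E ((legPar n P).op x) := by
  induction x using Finsupp.induction_linear with
  | zero => simp
  | add x y hx hy => simp only [map_add, hx, hy]
  | single σ a => rw [legPar_single, Finsupp.lsum_single, Finsupp.lsum_single, hE]

end LegOps

section Functionals

variable (𝕜 : Type) [RCLike 𝕜] {n : ℕ} (U : TopologicalSpace.Opens (Fin n → ℝ)) (m N : ℕ)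

/-- A leg of an integral functional: a density `f(x_j, [φ], [q], [q†])` at its own copy of the
base, together with the total derivatives that wait to be applied to it. The family `(f_σ)` stands
for `∑_σ (d/dx_j)^σ f_σ`, where the derivatives have been transported from the test shifts by the
(postponed) integrations by parts and are applied only after all the variations are over. -/
def Leg : Type := MultiIndex n →₀ Density 𝕜 U m N

instance : AddCommGroup (Leg 𝕜 U m N) := inferInstanceAs (AddCommGroup (_ →₀ Density 𝕜 U m N))
instance : Module 𝕜 (Leg 𝕜 U m N) := inferInstanceAs (Module 𝕜 (_ →₀ Density 𝕜 U m N))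

namespace Leg

/-- The ghost parity of legs. -/
def par : Parity 𝕜 (Leg 𝕜 U m N) := legPar n (Density.par 𝕜 U m N)

variable {𝕜 U m N}

/-- A density without waiting derivatives, as a leg. -/
def of : Density 𝕜 U m N →ₗ[𝕜] Leg 𝕜 U m N := Finsupp.lsingle 0

/-- The variation `∑_σ (-d/dx)^σ ∂/∂q^i_σ` with waiting derivatives. -/
def varQ (i : Fin N) : Leg 𝕜 U m N →ₗ[𝕜] Leg 𝕜 U m N :=
  legOp (fun σ => Density.pdEven (Sum.inr i, σ)) fun a =>
    (Density.pdEven_finite a).preimage fun _ _ _ _ h => (Prod.ext_iff.1 h).2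

/-- The variation `∑_σ (-d/dx)^σ ∂/∂q†_{i,σ}` with waiting derivatives. -/
def varQd (i : Fin N) : Leg 𝕜 U m N →ₗ[𝕜] Leg 𝕜 U m N :=
  legOp (fun σ => Density.pdOdd (i, σ)) fun a =>
    (Density.pdOdd_finite a).preimage fun _ _ _ _ h => (Prod.ext_iff.1 h).2

theorem par_varQ (i : Fin N) (x : Leg 𝕜 U m N) :
    (par 𝕜 U m N).op (varQ i x) = varQ i ((par 𝕜 U m N).op x) :=
  legPar_legOp_even _ _ (fun _ => Density.par_pdEven _) x

theorem par_varQd (i : Fin N) (x : Leg 𝕜 U m N) :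
    (par 𝕜 U m N).op (varQd i x) = -varQd i ((par 𝕜 U m N).op x) :=
  legPar_legOp_odd _ _ (fun _ => Density.par_pdOdd _) x

/-- Application of the waiting derivatives: `(f_σ) ↦ ∑_σ (d/dx)^σ f_σ`. -/
def eval : Leg 𝕜 U m N →ₗ[𝕜] Density 𝕜 U m N := Finsupp.lsum 𝕜 Density.totalDMulti

theorem par_eval (x : Leg 𝕜 U m N) :
    (Density.par 𝕜 U m N).op (eval x) = eval ((par 𝕜 U m N).op x) :=
  legPar_lsum _ Density.par_totalDMulti x

end Leg

/-- Integral functionals: the building blocks `∫ f(x, [φ], [q], [q†]) dvol(x)` and their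
descendants with any number of variations absorbed. An element is a sum of products of smooth
coefficients (the test shifts) and legs, all of them to be restricted to one and the same point
of the base. -/
def Block : Type := SmoothFun 𝕜 U ⊗[𝕜] SuperSym (Leg.par 𝕜 U m N)

instance : Ring (Block 𝕜 U m N) :=
  inferInstanceAs (Ring (SmoothFun 𝕜 U ⊗[𝕜] SuperSym (Leg.par 𝕜 U m N)))
instance : Algebra 𝕜 (Block 𝕜 U m N) :=
  inferInstanceAs (Algebra 𝕜 (SmoothFun 𝕜 U ⊗[𝕜] SuperSym (Leg.par 𝕜 U m N)))

namespace Block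

/-- The ghost parity of integral functionals. -/
def par : Parity 𝕜 (Block 𝕜 U m N) := tensorPar _ (SuperSym.par (Leg.par 𝕜 U m N))

theorem superComm : SuperComm (par 𝕜 U m N) := tensorPar_superComm (SuperSym.superComm _)

variable {𝕜 U m N}

theorem par_mul (a b : Block 𝕜 U m N) :
    (par 𝕜 U m N).op (a * b) = (par 𝕜 U m N).op a * (par 𝕜 U m N).op b :=
  tensorPar_mul SuperSym.par_mul a b

/-- A smooth coefficient. -/
def coeff (r : SmoothFun 𝕜 U) : Block 𝕜 U m N := r ⊗ₜ[𝕜] (1 : SuperSym (Leg.par 𝕜 U m N))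

theorem par_coeff (r : SmoothFun 𝕜 U) :
    (par 𝕜 U m N).op (coeff r : Block 𝕜 U m N) = coeff r := by
  change r ⊗ₜ[𝕜] (SuperSym.par (Leg.par 𝕜 U m N)).op 1 = _
  rw [SuperSym.par_one]
  rfl

/-- The building block `∫ f(x, [φ], [q], [q†]) dvol(x)`. -/
def of (f : Density 𝕜 U m N) : Block 𝕜 U m N :=
  (1 : SmoothFun 𝕜 U) ⊗ₜ[𝕜] SuperSym.ι (Leg.par 𝕜 U m N) (Leg.of f)

/-- The variation with respect to `q^i`, extended to products of legs by the Leibniz rule. -/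
def varQ (i : Fin N) : Block 𝕜 U m N →ₗ[𝕜] Block 𝕜 U m N :=
  LinearMap.lTensor (SmoothFun 𝕜 U)
    (SuperSym.evenExt (P := Leg.par 𝕜 U m N) (Leg.varQ i) (Leg.par_varQ i))

/-- The left variation with respect to `q†_i`, extended to products of legs by the graded Leibniz
rule. -/
def varQd (i : Fin N) : Block 𝕜 U m N →ₗ[𝕜] Block 𝕜 U m N :=
  LinearMap.lTensor (SmoothFun 𝕜 U)
    (SuperSym.oddExt (P := Leg.par 𝕜 U m N) (Leg.varQd i) (Leg.par_varQd i))

theorem par_varQ (i : Fin N) (x : Block 𝕜 U m N) :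
    (par 𝕜 U m N).op (varQ i x) = varQ i ((par 𝕜 U m N).op x) :=
  tensorPar_lTensor_even _ (SuperSym.par_evenExt _ _) x

theorem par_varQd (i : Fin N) (x : Block 𝕜 U m N) :
    (par 𝕜 U m N).op (varQd i x) = -varQd i ((par 𝕜 U m N).op x) :=
  tensorPar_lTensor_odd _ (SuperSym.par_oddExt _ _) x

end Block

/-- A test shift `(δs^i, δs†_i)`. -/
structure TestShift where
  even : Fin N → SmoothFun 𝕜 U
  odd : Fin N → SmoothFun 𝕜 U

/-- The normalization `δs^i(x) · δs†_i(x) ≡ 1` for every `i`. -/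
def TestShift.IsNormalized {𝕜 : Type} [RCLike 𝕜] {n : ℕ}
    {U : TopologicalSpace.Opens (Fin n → ℝ)} {N : ℕ} (δs : TestShift 𝕜 U N) : Prop :=
  ∀ i, δs.even i * δs.odd i = 1

variable {𝕜 U m N}

variable (m) in
/-- The BV-Laplacian `Δ = ∑_i δs^i δs†_i · δ/δq^i ∘ δ/δq†_i` and the Schouten bracket
`⟦F, G⟧ = ∑_i δs^i δs†_i · (δF/δq^i · δG/δq†_i - δᴿF/δq†_i · δG/δq^i)` on integral functionals, for
a given test shift; `δᴿ` is the variation with the derivative acting from the right. -/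
def blockOps (δs : TestShift 𝕜 U N) : BlockOps (Block.par 𝕜 U m N) :=
  BlockOps.ofDerivations (Block.superComm 𝕜 U m N) Block.par_mul
    (fun i => Block.coeff (δs.even i * δs.odd i)) Block.varQ Block.varQd
    (fun _ => Block.par_coeff _) Block.par_varQ Block.par_varQd

variable (𝕜 U m N)

/-- Local functionals with densities not yet evaluated: formal sums of formal products of integral
functionals, where the factors graded-commute. -/
def Functional : Type := SuperSym (Block.par 𝕜 U m N)

instance : Ring (Functional 𝕜 U m N) := inferInstanceAs (Ring (SuperSym (Block.par 𝕜 U m N)))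
instance : Algebra 𝕜 (Functional 𝕜 U m N) :=
  inferInstanceAs (Algebra 𝕜 (SuperSym (Block.par 𝕜 U m N)))

/-- The ghost parity of functionals. -/
def Functional.par : Parity 𝕜 (Functional 𝕜 U m N) := SuperSym.par (Block.par 𝕜 U m N)

variable {𝕜 U m N}

/-- An integral functional as a local functional. -/
def Block.toFunctional : Block 𝕜 U m N →ₗ[𝕜] Functional 𝕜 U m N := SuperSym.ι (Block.par 𝕜 U m N)

/-- The BV-Laplacian `Δ` on functionals, with the test shift `δs`. -/
def laplacian (δs : TestShift 𝕜 U N) : Functional 𝕜 U m N →ₗ[𝕜] Functional 𝕜 U m N :=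
  (blockOps m δs).laplacian

/-- The variational Schouten bracket `⟦F, G⟧` on functionals, with the test shift `δs`. -/
def schouten (δs : TestShift 𝕜 U N) :
    Functional 𝕜 U m N →ₗ[𝕜] Functional 𝕜 U m N →ₗ[𝕜] Functional 𝕜 U m N :=
  (blockOps m δs).schouten

variable (𝕜 U m N)

/-- The horizontal cohomology group `H̄ⁿ`: densities modulo total divergences. -/
def HorizontalCohomology : Type :=
  Density 𝕜 U m N ⧸ (⨆ k : Fin n, LinearMap.range (Density.totalD k : Density 𝕜 U m N →ₗ[𝕜] _))

instance : AddCommGroup (HorizontalCohomology 𝕜 U m N) :=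
  inferInstanceAs (AddCommGroup (Density 𝕜 U m N ⧸ _))
instance : Module 𝕜 (HorizontalCohomology 𝕜 U m N) :=
  inferInstanceAs (Module 𝕜 (Density 𝕜 U m N ⧸ _))

namespace HorizontalCohomology

variable {𝕜 U m N}

/-- The class `∫ f dx` of a density. -/
def mk : Density 𝕜 U m N →ₗ[𝕜] HorizontalCohomology 𝕜 U m N := Submodule.mkQ _

theorem par_divergence :
    (⨆ k : Fin n, LinearMap.range (Density.totalD k : Density 𝕜 U m N →ₗ[𝕜] _)) ≤
      (⨆ k : Fin n, LinearMap.range (Density.totalD k : Density 𝕜 U m N →ₗ[𝕜] _)).comap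
        (Density.par 𝕜 U m N).op := by
  refine iSup_le fun k => ?_
  rintro _ ⟨a, rfl⟩
  rw [Submodule.mem_comap, Density.par_totalD]
  exact Submodule.mem_iSup_of_mem k ⟨_, rfl⟩

variable (𝕜 U m N) in
/-- The ghost parity on horizontal cohomology. -/
def par : Parity 𝕜 (HorizontalCohomology 𝕜 U m N) where
  op := Submodule.mapQ _ _ (Density.par 𝕜 U m N).op par_divergence
  op_op v := by
    obtain ⟨a, rfl⟩ := Submodule.mkQ_surjective _ v
    change mk ((Density.par 𝕜 U m N).op ((Density.par 𝕜 U m N).op a)) = mk a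
    rw [Parity.op_op]

end HorizontalCohomology

variable {𝕜 U m N}

namespace Block

/-- The product of the legs at one point after the waiting derivatives are applied. -/
def evalLegs : SuperSym (Leg.par 𝕜 U m N) →ₐ[𝕜] Density 𝕜 U m N :=
  SuperSym.liftComm (Density.superComm 𝕜 U m N) Leg.eval Leg.par_eval

/-- The density of an integral functional with respect to `dx`, after the waiting derivatives are
applied and all the base points are restricted to the diagonal; `ρ(x, [φ], [q])` is the density of
the volume element `dvol`. -/
def eval (ρ : DiffFun 𝕜 U (Fin m ⊕ Fin N)) : Block 𝕜 U m N →ₗ[𝕜] Density 𝕜 U m N :=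
  TensorProduct.lift ((LinearMap.mul 𝕜 (Density 𝕜 U m N)).compl₁₂
    (Density.ofEven.toLinearMap ∘ₗ LinearMap.mulLeft 𝕜 ρ ∘ₗ
      (SmoothFun.toDiffFun 𝕜 U (Fin m ⊕ Fin N)).toLinearMap) evalLegs.toLinearMap)

theorem par_eval (ρ : DiffFun 𝕜 U (Fin m ⊕ Fin N)) (b : Block 𝕜 U m N) :
    (Density.par 𝕜 U m N).op (eval ρ b) = eval ρ ((par 𝕜 U m N).op b) := by
  induction b using TensorProduct.induction_on with
  | zero =>
    exact (map_zero ((Density.par 𝕜 U m N).op ∘ₗ eval ρ)).trans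
      (map_zero (eval ρ ∘ₗ (par 𝕜 U m N).op)).symm
  | add x y hx hy =>
    exact (map_add ((Density.par 𝕜 U m N).op ∘ₗ eval ρ) x y).trans
      ((congrArg₂ (· + ·) hx hy).trans (map_add (eval ρ ∘ₗ (par 𝕜 U m N).op) x y).symm)
  | tmul r X =>
    change (Density.par 𝕜 U m N).op (Density.ofEven (ρ * SmoothFun.toDiffFun 𝕜 U _ r) *
      evalLegs X) = Density.ofEven (ρ * SmoothFun.toDiffFun 𝕜 U _ r) *
      evalLegs ((SuperSym.par (Leg.par 𝕜 U m N)).op X)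
    rw [Density.par_mul, Density.par_ofEven, evalLegs,
      SuperSym.par_liftComm _ Density.par_one Density.par_mul]

end Block

variable (𝕜 U m N) in
/-- Local functionals: formal sums of graded-commutative products of elements of `H̄ⁿ`. -/
abbrev LocalFunctional : Type := SuperSym (HorizontalCohomology.par 𝕜 U m N)

/-- The local functional that is determined by a not yet evaluated functional: the waiting
derivatives are applied, the base points within every integral are restricted to the diagonal, and
the resulting densities are taken up to total divergences. -/
def realize (ρ : DiffFun 𝕜 U (Fin m ⊕ Fin N)) :
    Functional 𝕜 U m N →ₐ[𝕜] LocalFunctional 𝕜 U m N :=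
  SuperSym.map (P := Block.par 𝕜 U m N) (HorizontalCohomology.mk ∘ₗ Block.eval ρ) fun b =>
    congrArg HorizontalCohomology.mk (Block.par_eval ρ b)

end Functionals

end BV

end

/-! A variation differentiates the legs only. The coefficients, hence the test shifts, are constants
for it. The total derivatives which it creates are recorded as powers of $p$, and these commute with
one another and with every partial derivative. So all variations commute, two odd ones up to a sign.
Normalization makes each weight $\delta s^i\,\delta s^\dagger_i$ equal to $1$, so the two test
shifts define the same operators (`TestShift.IsNormalized.blockOps_eq`):
$\Delta=\sum_i\delta_i\delta_i^\dagger$ and the bracket generated by it.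

The engine is `lap_bracket_of_sq_zero`. If an odd operator $\Delta$ squares to zero and the bracket
measures its failure to be a derivation of a product, then expanding $\Delta^2=0$ on a product says
that $\Delta$ is a derivation of the bracket. On integral functionals, $\Delta^2=0$ because
exchanging the two summation indices reverses the sign (`lapOf_lapOf`), and the bracket is the
failure term by the Leibniz rules (`lapOf_mul`). This gives part 1.

On $\overline{\mathfrak N}$ the product is a formal one, different from the product of legs inside
an integral, and $\Delta$ is a Chevalley–Eilenberg operator assembled from the Laplacian and the
bracket of single factors. It squares to zero because integral functionals form a differential
graded Lie algebra with odd bracket (`IsDGLie`). Of its axioms, the derivation property is part 1,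
and the Jacobi identity follows from part 1: the bracket is a derivation in its second argument, so
part 1 applied to a bracket $[\![a,b\cdot c]\!]$, with the product taken inside the integral, leaves
exactly the Jacobi identity. The axioms pass to products of functionals through `inner_inner_even`,
`inner_inner_odd` and `laplacian_inner`, which yields `laplacian_laplacian`. With the product rule
`laplacian_mul`, the same engine gives part 2. Part 3 holds because the evaluation is linear. -/

namespace BV

/-! ### Derivations of a graded-symmetric algebra and their graded commutators. -/

section Derivations

variable {𝕜 : Type*} [Field 𝕜] [CharZero 𝕜] {V : Type*} [AddCommGroup V] [Module 𝕜 V]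
  {P : Parity 𝕜 V}

/-- Induction on the parity of a vector. -/
theorem Parity.induction (P : Parity 𝕜 V) {C : V → Prop} (hev : ∀ v, P.op v = v → C v)
    (hod : ∀ v, P.op v = -v → C v) (hadd : ∀ v w, C v → C w → C (v + w)) (v : V) : C v := by
  rw [← P.ev_add_od v]
  exact hadd _ _ (hev _ (P.op_ev v)) (hod _ (P.op_od v))

namespace SuperSym

theorem evenExt_one (d : V →ₗ[𝕜] V) (hd : ∀ v, P.op (d v) = d (P.op v)) :
    evenExt d hd (1 : SuperSym P) = 0 := recMap_one (evenCompat hd)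

theorem oddExt_one (d : V →ₗ[𝕜] V) (hd : ∀ v, P.op (d v) = -d (P.op v)) :
    oddExt d hd (1 : SuperSym P) = 0 := recMap_one (oddCompat hd)

/-- The defining recursion is the Leibniz rule for a product whose left factor is a generator;
induction on the left factor frees it from that restriction. -/
theorem evenExt_mul (d : V →ₗ[𝕜] V) (hd : ∀ v, P.op (d v) = d (P.op v)) (x y : SuperSym P) :
    evenExt d hd (x * y) = evenExt d hd x * y + x * evenExt d hd y := by
  induction x using SuperSym.inductionLeft with
  | h1 => rw [evenExt_one, one_mul, one_mul, zero_mul, zero_add]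
  | hsmul r x hx => simp only [map_smul, smul_mul_assoc, hx, smul_add]
  | hadd x z hx hz => simp only [map_add, add_mul, hx, hz]; abel
  | hmul v x hx =>
    simp only [mul_assoc, evenExt_ι_mul, hx, add_mul, mul_add]
    abel

theorem oddExt_mul (d : V →ₗ[𝕜] V) (hd : ∀ v, P.op (d v) = -d (P.op v)) (x y : SuperSym P) :
    oddExt d hd (x * y) = oddExt d hd x * y + (par P).op x * oddExt d hd y := by
  induction x using SuperSym.inductionLeft with
  | h1 => rw [oddExt_one, par_one, one_mul, one_mul, zero_mul, zero_add]
  | hsmul r x hx => simp only [map_smul, smul_mul_assoc, hx, smul_add]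
  | hadd x z hx hz => simp only [map_add, add_mul, hx, hz]; abel
  | hmul v x hx =>
    simp only [mul_assoc, oddExt_ι_mul, hx, add_mul, mul_add, par_mul, par_ι]
    abel

/-- The graded commutator of two derivations is again a derivation, so it vanishes once it vanishes
on generators. In the induction step this is the cancellation of the cross terms, in which each
operator hits a different factor. -/
theorem evenExt_evenExt {d d' : V →ₗ[𝕜] V} (hd : ∀ v, P.op (d v) = d (P.op v))
    (hd' : ∀ v, P.op (d' v) = d' (P.op v)) (h : ∀ v, d (d' v) = d' (d v)) (x : SuperSym P) :
    evenExt d hd (evenExt d' hd' x) = evenExt d' hd' (evenExt d hd x) := by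
  induction x using SuperSym.inductionLeft with
  | h1 => simp only [evenExt_one, map_zero]
  | hsmul r x hx => simp only [map_smul, hx]
  | hadd x y hx hy => simp only [map_add, hx, hy]
  | hmul v x hx =>
    simp only [evenExt_ι_mul, map_add, hx, h]
    abel

theorem evenExt_oddExt {d d' : V →ₗ[𝕜] V} (hd : ∀ v, P.op (d v) = d (P.op v))
    (hd' : ∀ v, P.op (d' v) = -d' (P.op v)) (h : ∀ v, d (d' v) = d' (d v)) (x : SuperSym P) :
    evenExt d hd (oddExt d' hd' x) = oddExt d' hd' (evenExt d hd x) := by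
  induction x using SuperSym.inductionLeft with
  | h1 => simp only [evenExt_one, oddExt_one, map_zero]
  | hsmul r x hx => simp only [map_smul, hx]
  | hadd x y hx hy => simp only [map_add, hx, hy]
  | hmul v x hx =>
    simp only [evenExt_ι_mul, oddExt_ι_mul, map_add, hx, h, hd]
    abel

theorem oddExt_oddExt {d d' : V →ₗ[𝕜] V} (hd : ∀ v, P.op (d v) = -d (P.op v))
    (hd' : ∀ v, P.op (d' v) = -d' (P.op v)) (h : ∀ v, d (d' v) = -d' (d v)) (x : SuperSym P) :
    oddExt d hd (oddExt d' hd' x) = -oddExt d' hd' (oddExt d hd x) := by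
  induction x using SuperSym.inductionLeft with
  | h1 => simp only [oddExt_one, map_zero, neg_zero]
  | hsmul r x hx => simp only [map_smul, hx, smul_neg]
  | hadd x y hx hy => simp only [map_add, hx, hy, neg_add]
  | hmul v x hx =>
    simp only [oddExt_ι_mul, map_add, hx, h, hd, hd', map_neg, neg_mul, mul_neg, P.op_op]
    abel

end SuperSym

end Derivations

/-! ### Extension of derivations by constant coefficients. -/

section Tensor

variable {𝕜 : Type*} [Field 𝕜] {R : Type*} [CommRing R] [Algebra 𝕜 R] {W : Type*} [Ring W] [Algebra 𝕜 W]
  {Q : Parity 𝕜 W}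

/-- The operator acts on the second tensor factor only. The elements of `R`, which will be the
smooth coefficients, behave as constants and the Leibniz rule is inherited. -/
theorem lTensor_mul_even {d : W →ₗ[𝕜] W} (hd : ∀ x y, d (x * y) = d x * y + x * d y)
    (x y : R ⊗[𝕜] W) :
    LinearMap.lTensor R d (x * y) = LinearMap.lTensor R d x * y + x * LinearMap.lTensor R d y := by
  induction x using TensorProduct.induction_on with
  | zero => simp
  | add a b ha hb => simp only [add_mul, map_add, ha, hb]; abel
  | tmul a b =>
    induction y using TensorProduct.induction_on with
    | zero => simp
    | add a b ha hb => simp only [mul_add, map_add, ha, hb]; abel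
    | tmul c e => simp [hd, TensorProduct.tmul_add]

theorem lTensor_mul_odd {d : W →ₗ[𝕜] W} (hd : ∀ x y, d (x * y) = d x * y + Q.op x * d y)
    (x y : R ⊗[𝕜] W) :
    LinearMap.lTensor R d (x * y) =
      LinearMap.lTensor R d x * y + (tensorPar R Q).op x * LinearMap.lTensor R d y := by
  induction x using TensorProduct.induction_on with
  | zero => simp
  | add a b ha hb => simp only [add_mul, map_add, ha, hb]; abel
  | tmul a b =>
    induction y using TensorProduct.induction_on with
    | zero => simp
    | add a b ha hb => simp only [mul_add, map_add, ha, hb]; abel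
    | tmul c e => simp [hd, TensorProduct.tmul_add, tensorPar]

end Tensor

/-! ### Operators with waiting total derivatives. -/

section LegOps

variable {𝕜 : Type*} [Field 𝕜] {A : Type*} [AddCommGroup A] [Module 𝕜 A] {n : ℕ}

/-- Vanishing terms are harmless, so the index set may be any finite set that contains the support.
This freedom lets two iterated sums run over one common rectangle. -/
theorem legOp_single_eq_sum (D : MultiIndex n → A →ₗ[𝕜] A) (h : ∀ a, {τ | D τ a ≠ 0}.Finite)
    (σ : MultiIndex n) (a : A) {T : Finset (MultiIndex n)} (hT : ∀ τ, D τ a ≠ 0 → τ ∈ T) :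
    legOp D h (Finsupp.single σ a) =
      ∑ τ ∈ T, Finsupp.single (σ + τ) ((-1 : 𝕜) ^ τ.degree • D τ a) := by
  rw [legOp_single, Finsupp.mapDomain, Finsupp.sum]
  refine Finset.sum_subset (fun τ hτ => hT τ fun h0 => ?_) fun τ _ hτ => ?_
  · rw [Finsupp.mem_support_iff, pack_apply, LinearMap.smul_apply, h0, smul_zero] at hτ
    exact hτ rfl
  · rw [Finsupp.notMem_support_iff] at hτ
    rw [hτ, Finsupp.single_zero]

/-- Multiplication by $p^\tau$ commutes with the coefficient operators and with $p^\rho$, so an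
exchange rule for the coefficients alone becomes one for the series $\sum(-p)^\rho D_\rho$ and
$\sum(-p)^\tau E_\tau$. -/
theorem legOp_legOp {D E : MultiIndex n → A →ₗ[𝕜] A} (hD : ∀ a, {τ | D τ a ≠ 0}.Finite)
    (hE : ∀ a, {τ | E τ a ≠ 0}.Finite) (c : 𝕜) (h : ∀ ρ τ a, D ρ (E τ a) = c • E τ (D ρ a))
    (x : MultiIndex n →₀ A) : legOp D hD (legOp E hE x) = c • legOp E hE (legOp D hD x) := by
  classical
  induction x using Finsupp.induction_linear with
  | zero => simp
  | add x y hx hy => simp only [map_add, hx, hy, smul_add]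
  | single σ a =>
    set S := (hD a).toFinset with hS
    set T := (hE a).toFinset with hT
    -- The exchange rule bounds the support of `D` on every `E τ a` by its support on `a`, uniformly
    -- in `τ`.
    have hDE : ∀ τ ρ, D ρ ((-1 : 𝕜) ^ τ.degree • E τ a) ≠ 0 → ρ ∈ S := by
      intro τ ρ h0
      rw [hS, Set.Finite.mem_toFinset]
      rintro h1
      exact h0 (by rw [map_smul, h, h1, map_zero, smul_zero, smul_zero])
    -- The opposite bound, for `E` on `D ρ a`, requires division by `c`. For `c = 0` it is not
    -- needed, since every composition `D ρ (E τ a)` vanishes.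
    by_cases hc : c = 0
    · subst hc
      rw [legOp_single_eq_sum E hE σ a (T := T) (by simp [hT]), map_sum, zero_smul]
      refine Finset.sum_eq_zero fun τ _ => ?_
      rw [legOp_single_eq_sum D hD _ _ (hDE τ)]
      exact Finset.sum_eq_zero fun ρ _ => by simp [h]
    have hED : ∀ ρ τ, E τ ((-1 : 𝕜) ^ ρ.degree • D ρ a) ≠ 0 → τ ∈ T := by
      intro ρ τ h0
      rw [hT, Set.Finite.mem_toFinset]
      rintro h1
      refine h0 ?_
      have h2 := h ρ τ a
      rw [h1, map_zero] at h2
      rw [map_smul, (smul_eq_zero.1 h2.symm).resolve_left hc, smul_zero]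
    rw [legOp_single_eq_sum E hE σ a (T := T) (by simp [hT]),
      legOp_single_eq_sum D hD σ a (T := S) (by simp [hS]), map_sum, map_sum, Finset.smul_sum]
    simp_rw [legOp_single_eq_sum D hD _ _ (hDE _), legOp_single_eq_sum E hE _ _ (hED _),
      Finset.smul_sum]
    rw [Finset.sum_comm]
    -- Both sides now run over `S × T`; the exponents $\sigma+\tau+\rho$ and the signs agree in
    -- either order, and the exchange rule supplies `c`.
    refine Finset.sum_congr rfl fun ρ _ => Finset.sum_congr rfl fun τ _ => ?_
    rw [Finsupp.smul_single, map_smul, map_smul, h, add_right_comm]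
    congr 1
    simp only [smul_smul]
    congr 1
    ring

end LegOps

/-! ### Commutation of partial derivatives, lifted to legs and to integral functionals. -/

section Variations

variable {𝕜 : Type} [RCLike 𝕜] {n : ℕ} {U : TopologicalSpace.Opens (Fin n → ℝ)} {m N : ℕ}

/-- Differential functions depend on finitely many coordinates, so this is the symmetry of the
second derivative of a smooth function on an open set in a finite-dimensional space. -/
theorem dirDeriv_comm {I : Type} (ξ ξ' : Fin n → ℝ) (v v' : JetIndex n I → ℝ)
    {f : U → (JetIndex n I → ℝ) → 𝕜} (hf : IsDiffFun 𝕜 U I f) :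
    dirDeriv ξ v (dirDeriv ξ' v' f) = dirDeriv ξ' v' (dirDeriv ξ v f) := by
  obtain ⟨S, g, hg, e⟩ := hf
  have hU : IsOpen ((U : Set (Fin n → ℝ)) ×ˢ (Set.univ : Set (S → ℝ))) :=
    U.isOpen.prod isOpen_univ
  have hg' := hg.fderiv_of_isOpen hU (m := ∞) (by simp)
  -- One representative `g` on the coordinates `S` serves both orders: a directional derivative
  -- introduces no new jet coordinates.
  have key : ∀ (ζ ζ' : Fin n → ℝ) (w w' : JetIndex n I → ℝ) (x : U) (u : JetIndex n I → ℝ),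
      dirDeriv ζ w (dirDeriv ζ' w' f) x u = fderiv ℝ (fderiv ℝ g) (x, fun s => u s)
        (ζ, fun s => w s) (ζ', fun s => w' s) := by
    intro ζ ζ' w w' x u
    rw [dirDeriv_eq ζ w (hg'.clm_apply contDiffOn_const) fun x u => dirDeriv_eq ζ' w' hg e x u]
    have hd : DifferentiableAt ℝ (fderiv ℝ g) ((x : Fin n → ℝ), fun s : S => u s) :=
      (hg'.contDiffAt (hU.mem_nhds ⟨x.2, trivial⟩)).differentiableAt (by simp)
    rw [fderiv_clm_apply hd (differentiableAt_const _)]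
    simp
  funext x u
  rw [key, key]
  have hs : IsSymmSndFDerivAt ℝ g ((x : Fin n → ℝ), fun s : S => u s) :=
    (hg.contDiffAt (hU.mem_nhds ⟨x.2, trivial⟩)).isSymmSndFDerivAt
      (by simpa using (mod_cast le_top : ((2 : ℕ∞) : WithTop ℕ∞) ≤ ∞))
  exact hs _ _

theorem DiffFun.dir_comm {I : Type} (ξ ξ' : Fin n → ℝ) (v v' : JetIndex n I → ℝ)
    (f : DiffFun 𝕜 U I) :
    DiffFun.dir ξ v (DiffFun.dir ξ' v' f) = DiffFun.dir ξ' v' (DiffFun.dir ξ v f) :=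
  Subtype.ext (dirDeriv_comm ξ ξ' v v' f.2)

namespace Density

theorem pdEven_pdEven (s t : JetIndex n (Fin m ⊕ Fin N)) (a : Density 𝕜 U m N) :
    pdEven s (pdEven t a) = pdEven t (pdEven s a) := by
  have h : DiffFun.pdU s ∘ₗ DiffFun.pdU t =
      (DiffFun.pdU t ∘ₗ DiffFun.pdU s : DiffFun 𝕜 U (Fin m ⊕ Fin N) →ₗ[𝕜] _) :=
    LinearMap.ext fun f => DiffFun.dir_comm _ _ _ _ f
  exact LinearMap.congr_fun ((LinearMap.rTensor_comp (OddAlg 𝕜 n N) _ _).symm.trans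
    ((congrArg (LinearMap.rTensor (OddAlg 𝕜 n N)) h).trans (LinearMap.rTensor_comp _ _ _))) a

theorem pdEven_pdOdd (s : JetIndex n (Fin m ⊕ Fin N)) (t : JetIndex n (Fin N))
    (a : Density 𝕜 U m N) : pdEven s (pdOdd t a) = pdOdd t (pdEven s a) :=
  LinearMap.congr_fun ((LinearMap.rTensor_comp_lTensor _ _ _).trans
    (LinearMap.lTensor_comp_rTensor _ _ _).symm) a

theorem pdOdd_pdOdd (s t : JetIndex n (Fin N)) (a : Density 𝕜 U m N) :
    pdOdd s (pdOdd t a) = -pdOdd t (pdOdd s a) := by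
  have h : OddAlg.pd s ∘ₗ OddAlg.pd t =
      (-(OddAlg.pd t ∘ₗ OddAlg.pd s) : OddAlg 𝕜 n N →ₗ[𝕜] OddAlg 𝕜 n N) :=
    LinearMap.ext fun x => CliffordAlgebra.contractLeft_comm _ _ x
  exact LinearMap.congr_fun
    ((LinearMap.lTensor_comp (DiffFun 𝕜 U (Fin m ⊕ Fin N)) _ _).symm.trans
      ((congrArg (LinearMap.lTensor (DiffFun 𝕜 U (Fin m ⊕ Fin N))) h).trans
        ((LinearMap.lTensor_neg _).trans (congrArg _ (LinearMap.lTensor_comp _ _ _))))) a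

end Density

namespace Leg

/-- The exchange constant of the partial derivatives is $1$ as soon as one of them is even, and $-1$
for two odd ones. The variations inherit it because the waiting derivatives are not performed. -/
theorem varQ_varQ (i j : Fin N) (x : Leg 𝕜 U m N) : varQ i (varQ j x) = varQ j (varQ i x) :=
  (legOp_legOp _ _ 1 (fun _ _ a => by rw [one_smul, Density.pdEven_pdEven]) x).trans (one_smul _ _)

theorem varQ_varQd (i j : Fin N) (x : Leg 𝕜 U m N) : varQ i (varQd j x) = varQd j (varQ i x) :=
  (legOp_legOp _ _ 1 (fun _ _ a => by rw [one_smul, Density.pdEven_pdOdd]) x).trans (one_smul _ _)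

theorem varQd_varQd (i j : Fin N) (x : Leg 𝕜 U m N) :
    varQd i (varQd j x) = -varQd j (varQd i x) :=
  (legOp_legOp _ _ (-1) (fun _ _ a => by rw [neg_one_smul, Density.pdOdd_pdOdd]) x).trans
    (neg_one_smul _ _)

end Leg

namespace Block

theorem varQ_mul (i : Fin N) (x y : Block 𝕜 U m N) :
    varQ i (x * y) = varQ i x * y + x * varQ i y :=
  lTensor_mul_even (SuperSym.evenExt_mul _ _) x y

theorem varQd_mul (i : Fin N) (x y : Block 𝕜 U m N) :
    varQd i (x * y) = varQd i x * y + (par 𝕜 U m N).op x * varQd i y :=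
  lTensor_mul_odd (SuperSym.oddExt_mul _ _) x y

theorem varQ_varQ (i j : Fin N) (x : Block 𝕜 U m N) : varQ i (varQ j x) = varQ j (varQ i x) :=
  LinearMap.congr_fun ((LinearMap.lTensor_comp _ _ _).symm.trans
    ((congrArg (LinearMap.lTensor (SmoothFun 𝕜 U)) (LinearMap.ext
      (SuperSym.evenExt_evenExt _ _ (Leg.varQ_varQ i j)))).trans (LinearMap.lTensor_comp _ _ _))) x

theorem varQ_varQd (i j : Fin N) (x : Block 𝕜 U m N) : varQ i (varQd j x) = varQd j (varQ i x) :=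
  LinearMap.congr_fun ((LinearMap.lTensor_comp _ _ _).symm.trans
    ((congrArg (LinearMap.lTensor (SmoothFun 𝕜 U)) (LinearMap.ext
      (SuperSym.evenExt_oddExt _ _ (Leg.varQ_varQd i j)))).trans (LinearMap.lTensor_comp _ _ _))) x

theorem varQd_varQd (i j : Fin N) (x : Block 𝕜 U m N) :
    varQd i (varQd j x) = -varQd j (varQd i x) := by
  have h : SuperSym.oddExt (Leg.varQd i) (Leg.par_varQd i) ∘ₗ
      SuperSym.oddExt (Leg.varQd j) (Leg.par_varQd j) =
      -(SuperSym.oddExt (Leg.varQd j) (Leg.par_varQd j) ∘ₗ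
        SuperSym.oddExt (P := Leg.par 𝕜 U m N) (Leg.varQd i) (Leg.par_varQd i)) :=
    LinearMap.ext (SuperSym.oddExt_oddExt _ _ (Leg.varQd_varQd i j))
  exact LinearMap.congr_fun
    ((LinearMap.lTensor_comp _ _ _).symm.trans
      ((congrArg (LinearMap.lTensor (SmoothFun 𝕜 U)) h).trans
        ((LinearMap.lTensor_neg _).trans (congrArg _ (LinearMap.lTensor_comp _ _ _))))) x

end Block

end Variations

/-! ### Square-zero operators and the brackets they generate. -/

section SecondOrder

variable {𝕜 : Type*} [Field 𝕜] {A : Type*} [Ring A] [Algebra 𝕜 A] {P : Parity 𝕜 A}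

/-- An odd operator `Δ` of square zero is a derivation of the bracket that measures its failure
to be a derivation of the product. -/
theorem lap_bracket_of_sq_zero {Δ : A →ₗ[𝕜] A} {br : A →ₗ[𝕜] A →ₗ[𝕜] A}
    (hp : ∀ x, P.op (Δ x) = -Δ (P.op x)) (h2 : ∀ x, Δ (Δ x) = 0)
    (hm : ∀ x y, Δ (x * y) = Δ x * y + br (P.op x) y + P.op x * Δ y) (x y : A) :
    Δ (br x y) = br (Δ x) y - br (P.op x) (Δ y) := by
  -- The parity involution on `x` is undone by the product rule, so that `br x y` itself appears
  -- inside `Δ`. In the expansion the two terms `Δ x * Δ y` have opposite signs and cancel.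
  have h := h2 (P.op x * y)
  simp only [hm, map_add, h2, hp, P.op_op, map_neg, LinearMap.neg_apply, neg_mul, mul_zero,
    zero_mul] at h
  rw [← sub_eq_zero, ← h]
  abel

theorem Parity.IsHomogeneous.neg_op {V : Type*} [AddCommGroup V] [Module 𝕜 V] {P : Parity 𝕜 V}
    {a : ℤ} {x : V} (hx : P.IsHomogeneous a x) : -P.op x = (-1 : 𝕜) ^ (a - 1) • x := by
  rw [zpow_sub_one₀ (neg_ne_zero.2 one_ne_zero), inv_neg_one, mul_neg_one, neg_smul, ← hx]

/-- The signed form of an identity stated through the parity involution. -/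
theorem Parity.IsHomogeneous.eq_add_smul {V W X : Type*} [AddCommGroup V] [Module 𝕜 V]
    [AddCommGroup W] [Module 𝕜 W] [AddCommGroup X] [Module 𝕜 X] {P : Parity 𝕜 V} {a : ℤ} {x : V}
    (hx : P.IsHomogeneous a x) (f : V →ₗ[𝕜] W →ₗ[𝕜] X) {u v : X} {y : W}
    (h : u = v - f (P.op x) y) : u = v + (-1 : 𝕜) ^ (a - 1) • f x y := by
  rw [h, ← LinearMap.smul_apply, ← map_smul, ← hx.neg_op, map_neg, LinearMap.neg_apply,
    sub_eq_add_neg]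

end SecondOrder

/-! ### The unweighted Laplacian and bracket in a graded-commutative algebra. -/

section OfDerivations

variable {𝕜 : Type*} [Field 𝕜] {B : Type*} [Ring B] [Algebra 𝕜 B] {P : Parity 𝕜 B} {ι : Type*}
  [Fintype ι] {δ δd : ι → B →ₗ[𝕜] B}

/-- Of the four terms of $\delta_i\delta_i^\dagger(ab)$, the two in which the derivations hit
different factors form the bracket. -/
theorem lapOf_mul (hδm : ∀ i a b, δ i (a * b) = δ i a * b + a * δ i b)
    (hδdm : ∀ i a b, δd i (a * b) = δd i a * b + P.op a * δd i b) (a b : B) :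
    lapOf 1 δ δd (a * b) =
      lapOf 1 δ δd a * b + brOf P 1 δ δd (P.op a) b + P.op a * lapOf 1 δ δd b := by
  simp only [lapOf_apply, brOf_apply, Pi.one_apply, one_mul, Finset.sum_mul, Finset.mul_sum,
    ← Finset.sum_add_distrib, hδm, hδdm, map_add, P.op_op]
  exact Finset.sum_congr rfl fun i _ => by abel

/-- Reordering $\delta_i\delta_i^\dagger\delta_j\delta_j^\dagger$ into
$\delta_j\delta_j^\dagger\delta_i\delta_i^\dagger$ costs one sign, from the two odd derivations.
Renaming the indices makes the double sum equal to its negative, and characteristic zero finishes.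
-/
theorem lapOf_lapOf [CharZero 𝕜] (hδδ : ∀ i j a, δ i (δ j a) = δ j (δ i a))
    (hδδd : ∀ i j a, δ i (δd j a) = δd j (δ i a))
    (hδdδd : ∀ i j a, δd i (δd j a) = -δd j (δd i a)) (a : B) :
    lapOf 1 δ δd (lapOf 1 δ δd a) = 0 := by
  simp only [lapOf_apply, Pi.one_apply, one_mul, map_sum]
  set S := ∑ j, ∑ i, δ i (δd i (δ j (δd j a))) with hS
  have h : S = -S := by
    conv_lhs => rw [hS, Finset.sum_comm]
    rw [hS, ← Finset.sum_neg_distrib]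
    refine Finset.sum_congr rfl fun i _ => ?_
    rw [← Finset.sum_neg_distrib]
    refine Finset.sum_congr rfl fun j _ => ?_
    rw [← hδδd j i, ← hδδd i j, hδδ i j, hδdδd i j, map_neg, map_neg]
  have h2 : (2 : 𝕜) • S = 0 := by
    rw [two_smul]
    nth_rewrite 2 [h]
    exact add_neg_cancel S
  exact (smul_eq_zero.1 h2).resolve_left two_ne_zero

/-- For fixed `a` the bracket is a combination of the derivations $\delta_i$ and $\delta_i^\dagger$,
of first order in its second argument and of parity $|a|-1$. For even `a` it is an odd derivation,
whence the involution on `b`; graded commutativity moves `b` past the coefficients. -/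
theorem brOf_mul_even (hP : SuperComm P) (hδ : ∀ i a, P.op (δ i a) = δ i (P.op a))
    (hδd : ∀ i a, P.op (δd i a) = -δd i (P.op a))
    (hδm : ∀ i a b, δ i (a * b) = δ i a * b + a * δ i b)
    (hδdm : ∀ i a b, δd i (a * b) = δd i a * b + P.op a * δd i b) {a : B} (ha : P.op a = a)
    (b c : B) :
    brOf P 1 δ δd a (b * c) = brOf P 1 δ δd a b * c + P.op b * brOf P 1 δ δd a c := by
  simp only [brOf_apply, Pi.one_apply, one_mul, Finset.sum_mul, Finset.mul_sum,
    ← Finset.sum_add_distrib]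
  refine Finset.sum_congr rfl fun i _ => ?_
  have h1 : P.op b * δ i a = δ i a * P.op b := (hP _ _).1 (by rw [hδ, ha])
  have h2 : P.op b * δd i a = δd i a * b := by
    rw [(hP (δd i a) _).2 (by rw [hδd, ha]), P.op_op]
  rw [ha, hδm, hδdm, mul_add (P.op b), ← mul_assoc (P.op b), ← mul_assoc (P.op b), h1, h2]
  noncomm_ring

theorem brOf_mul_odd (hP : SuperComm P) (hδ : ∀ i a, P.op (δ i a) = δ i (P.op a))
    (hδd : ∀ i a, P.op (δd i a) = -δd i (P.op a))
    (hδm : ∀ i a b, δ i (a * b) = δ i a * b + a * δ i b)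
    (hδdm : ∀ i a b, δd i (a * b) = δd i a * b + P.op a * δd i b) {a : B} (ha : P.op a = -a)
    (b c : B) :
    brOf P 1 δ δd a (b * c) = brOf P 1 δ δd a b * c + b * brOf P 1 δ δd a c := by
  simp only [brOf_apply, Pi.one_apply, one_mul, Finset.sum_mul, Finset.mul_sum,
    ← Finset.sum_add_distrib]
  refine Finset.sum_congr rfl fun i _ => ?_
  have h1 : b * δ i a = δ i a * P.op b := (hP _ _).2 (by rw [hδ, ha, map_neg])
  have h2 : b * δd i a = δd i a * b := (hP _ _).1 (by rw [hδd, ha, map_neg, neg_neg])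
  rw [ha, map_neg, hδm, hδdm, mul_add b, ← mul_assoc b, ← mul_assoc b, mul_neg, h1, h2]
  noncomm_ring

end OfDerivations

/-! ### The differential graded Lie algebra of a second-order operator. -/

namespace BlockOps

variable {𝕜 : Type*} [Field 𝕜] {V : Type*} [AddCommGroup V] [Module 𝕜 V] {P : Parity 𝕜 V}

/-- The axioms of a differential graded Lie algebra with an odd bracket. -/
structure IsDGLie (O : BlockOps P) : Prop where
  lap_lap : ∀ a, O.lap (O.lap a) = 0
  lap_br : ∀ a b, O.lap (O.br a b) = O.br (O.lap a) b - O.br (P.op a) (O.lap b)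
  jacobi_even : ∀ a b c, P.op a = a →
    O.br a (O.br b c) + O.br (P.op b) (O.br a c) = O.br (O.br a b) c
  jacobi_odd : ∀ a b c, P.op a = -a → O.br a (O.br b c) - O.br b (O.br a c) = O.br (O.br a b) c

/-- In a graded-commutative algebra with an odd second-order operator of square zero, the operator
and the bracket that it generates obey the axioms of a differential graded Lie algebra. -/
theorem isDGLie_of_sq_zero {B : Type*} [Ring B] [Algebra 𝕜 B] {P : Parity 𝕜 B} (O : BlockOps P)
    (h2 : ∀ a, O.lap (O.lap a) = 0)
    (hm : ∀ a b, O.lap (a * b) = O.lap a * b + O.br (P.op a) b + P.op a * O.lap b)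
    (he : ∀ a b c, P.op a = a → O.br a (b * c) = O.br a b * c + P.op b * O.br a c)
    (ho : ∀ a b c, P.op a = -a → O.br a (b * c) = O.br a b * c + b * O.br a c) : O.IsDGLie where
  lap_lap := h2
  lap_br := lap_bracket_of_sq_zero O.par_lap h2 hm
  jacobi_even a b c ha := by
    have hd := lap_bracket_of_sq_zero O.par_lap h2 hm
    -- The derivation property on a product: the product rule of `lap` breaks off `br b c`, the
    -- involution on `b` being undone there. All terms with `lap` cancel, and the three double
    -- brackets remain.
    have h := hd a (P.op b * c)
    have hla : P.op (O.lap a) = -O.lap a := by rw [O.par_lap, ha]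
    simp only [he _ _ _ ha, ho _ _ _ hla, hm, hd, map_add, map_neg, O.par_lap, O.par_br, ha,
      P.op_op, mul_sub, sub_mul, LinearMap.neg_apply, neg_mul] at h
    rw [← sub_eq_zero] at h ⊢
    rw [← h]
    abel
  jacobi_odd a b c ha := by
    have hd := lap_bracket_of_sq_zero O.par_lap h2 hm
    have h := hd a (P.op b * c)
    have hla : P.op (O.lap a) = O.lap a := by rw [O.par_lap, ha, map_neg, neg_neg]
    simp only [ho _ _ _ ha, he _ _ _ hla, hm, hd, map_add, map_neg, O.par_br, ha,
      P.op_op, LinearMap.neg_apply, neg_neg, sub_neg_eq_add, mul_add, add_mul] at h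
    rw [← sub_eq_zero] at h ⊢
    rw [← neg_eq_zero, ← h]
    abel

end BlockOps

/-! ### Lift of the differential graded Lie structure to formal products. -/

namespace BlockOps

open SuperSym

variable {𝕜 : Type*} [Field 𝕜] [CharZero 𝕜] {V : Type*} [AddCommGroup V] [Module 𝕜 V]
  {P : Parity 𝕜 V} (O : BlockOps P)

theorem inner_one (b : V) : O.inner (1 : SuperSym P) b = 0 := by
  rw [inner, recMap_one, LinearMap.zero_apply]

theorem laplacian_one : O.laplacian (1 : SuperSym P) = 0 := recMap_one O.lapCompat

theorem schouten_one (H : SuperSym P) : O.schouten 1 H = 0 := by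
  rw [schouten, recMap_one, LinearMap.zero_apply]

theorem laplacian_ι_mul (b : V) (G : SuperSym P) : O.laplacian (ι P b * G) =
    ι P (O.lap b) * G + O.inner G (P.op b) + ι P (P.op b) * O.laplacian G :=
  recMap_ι_mul O.lapCompat b G

theorem schouten_ι_mul (b : V) (G H : SuperSym P) : O.schouten (ι P b * G) H =
    G * O.inner H (P.ev b) + (par P).op G * O.inner H (P.od b) + ι P b * O.schouten G H := by
  rw [schouten, recMap_ι_mul]
  rfl

/-- Once the parity of `b` is fixed, the even and odd components of `c` recombine into a single
sign: $⟦b,\cdot⟧$ is an odd derivation for even `b`, and an even one for odd `b`. -/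
theorem inner_even {b : V} (hb : P.op b = b) (c : V) (G : SuperSym P) :
    O.inner (ι P c * G) b = ι P (O.br b c) * G + ι P (P.op c) * O.inner G b := by
  have h : P.op c = P.ev c - P.od c := by
    conv_lhs => rw [← P.ev_add_od c, map_add, P.op_ev, P.op_od, ← sub_eq_add_neg]
  rw [inner_ι_mul, hb, h, map_sub, sub_mul]

theorem inner_odd {b : V} (hb : P.op b = -b) (c : V) (G : SuperSym P) :
    O.inner (ι P c * G) b = ι P (O.br b c) * G + ι P c * O.inner G b := by
  rw [inner_ι_mul, hb, map_neg, mul_neg, sub_neg_eq_add, ← add_mul, ← map_add, P.ev_add_od]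

theorem inner_mul_even {b : V} (hb : P.op b = b) (F G : SuperSym P) :
    O.inner (F * G) b = O.inner F b * G + (par P).op F * O.inner G b := by
  induction F using SuperSym.inductionLeft with
  | h1 => rw [inner_one, par_one, one_mul, one_mul, zero_mul, zero_add]
  | hsmul r x hx =>
    simp only [map_smul, smul_mul_assoc, LinearMap.smul_apply, hx, smul_add]
  | hadd x y hx hy => simp only [map_add, add_mul, LinearMap.add_apply, hx, hy]; abel
  | hmul v x hx =>
    simp only [mul_assoc, O.inner_even hb, hx, par_mul, par_ι, mul_add, add_mul]
    abel

theorem inner_mul_odd {b : V} (hb : P.op b = -b) (F G : SuperSym P) :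
    O.inner (F * G) b = O.inner F b * G + F * O.inner G b := by
  induction F using SuperSym.inductionLeft with
  | h1 => rw [inner_one, one_mul, one_mul, zero_mul, zero_add]
  | hsmul r x hx =>
    simp only [map_smul, smul_mul_assoc, LinearMap.smul_apply, hx, smul_add]
  | hadd x y hx hy => simp only [map_add, add_mul, LinearMap.add_apply, hx, hy]; abel
  | hmul v x hx =>
    simp only [mul_assoc, O.inner_odd hb, hx, mul_add, add_mul]
    abel

/-- One induction covers both operators, because the recursion for the Laplacian calls the bracket
with a single functional. -/
theorem par_laplacian_inner (x : SuperSym P) :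
    (∀ b, (par P).op (O.inner x b) = -O.inner ((par P).op x) (P.op b)) ∧
      (par P).op (O.laplacian x) = -O.laplacian ((par P).op x) := by
  induction x using SuperSym.inductionLeft with
  | h1 => simp [par_one, inner_one, laplacian_one]
  | hsmul r x hx =>
    exact ⟨fun b => by simp only [map_smul, LinearMap.smul_apply, hx.1, smul_neg],
      by simp only [map_smul, hx.2, smul_neg]⟩
  | hadd x y hx hy =>
    exact ⟨fun b => by simp only [map_add, LinearMap.add_apply, hx.1, hy.1, neg_add],
      by simp only [map_add, hx.2, hy.2, neg_add]⟩
  | hmul v x hx =>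
    constructor
    · intro b
      induction b using P.induction with
      | hev b hb =>
        simp only [par_mul, par_ι, hb, O.inner_even hb, map_add, O.par_br, hx.1, map_neg, neg_mul,
          mul_neg, neg_add]
      | hod b hb =>
        simp only [par_mul, par_ι, hb, O.inner_odd hb, map_add, O.par_br, hx.1, map_neg,
          LinearMap.neg_apply, neg_neg]
      | hadd b c hb hc => simp only [map_add, hb, hc, neg_add]
    · simp only [par_mul, par_ι, laplacian_ι_mul, map_add, O.par_lap, hx.1, hx.2, map_neg, neg_mul,
        mul_neg, neg_add]

variable {O}

/-- The graded commutator of the derivations $⟦b,\cdot⟧$ and $⟦c,\cdot⟧$ is a derivation, and on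
generators it is $⟦⟦b,c⟧,\cdot⟧$ by the Jacobi identity. For even `b` it is an anticommutator or a
commutator according to the parity of `c`, as the involution on `c` records. -/
theorem IsDGLie.inner_inner_even (h : O.IsDGLie) {b : V} (hb : P.op b = b) (c : V)
    (x : SuperSym P) :
    O.inner (O.inner x c) b + O.inner (O.inner x b) (P.op c) = O.inner x (O.br b c) := by
  induction c using P.induction generalizing x with
  | hadd c d hc hd => simp only [map_add, LinearMap.add_apply, ← hc, ← hd]; abel
  | hev c hc =>
    have hbc : P.op (O.br b c) = -O.br b c := by rw [O.par_br, hb, hc]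
    rw [hc]
    induction x using SuperSym.inductionLeft with
    | h1 => simp only [inner_one, map_zero, LinearMap.zero_apply, add_zero]
    | hsmul r x hx => simp only [map_smul, LinearMap.smul_apply, ← hx, smul_add]
    | hadd x y hx hy => simp only [map_add, LinearMap.add_apply, ← hx, ← hy]; abel
    | hmul v x hx =>
      simp only [O.inner_even hb, O.inner_even hc, O.inner_odd hbc, map_add, LinearMap.add_apply,
        O.par_br, hb, hc, P.op_op, ← hx, ← h.jacobi_even b c v hb, map_neg, neg_mul, mul_add,
        add_mul]
      abel
  | hod c hc =>
    have hbc : P.op (O.br b c) = O.br b c := by rw [O.par_br, hb, hc, map_neg, neg_neg]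
    rw [hc]
    induction x using SuperSym.inductionLeft with
    | h1 => simp only [inner_one, map_zero, LinearMap.zero_apply, add_zero]
    | hsmul r x hx => simp only [map_smul, LinearMap.smul_apply, ← hx, smul_add]
    | hadd x y hx hy => simp only [map_add, LinearMap.add_apply, ← hx, ← hy]; abel
    | hmul v x hx =>
      simp only [map_neg] at hx ⊢
      simp only [O.inner_even hb, O.inner_odd hc, O.inner_even hbc, map_add, LinearMap.add_apply,
        O.par_br, hc, ← hx, ← h.jacobi_even b c v hb, map_neg, neg_mul, mul_add,
        add_mul, LinearMap.neg_apply, mul_neg, neg_neg]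
      abel

/-- Here $⟦b,\cdot⟧$ is an even derivation, so a plain commutator appears for either parity of `c`.
-/
theorem IsDGLie.inner_inner_odd (h : O.IsDGLie) {b : V} (hb : P.op b = -b) (c : V)
    (x : SuperSym P) :
    O.inner (O.inner x c) b - O.inner (O.inner x b) c = O.inner x (O.br b c) := by
  induction c using P.induction generalizing x with
  | hadd c d hc hd => simp only [map_add, LinearMap.add_apply, ← hc, ← hd]; abel
  | hev c hc =>
    have hbc : P.op (O.br b c) = O.br b c := by
      rw [O.par_br, hb, hc, map_neg, LinearMap.neg_apply, neg_neg]
    induction x using SuperSym.inductionLeft with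
    | h1 => simp only [inner_one, map_zero, LinearMap.zero_apply, sub_zero]
    | hsmul r x hx => simp only [map_smul, LinearMap.smul_apply, ← hx, smul_sub]
    | hadd x y hx hy => simp only [map_add, LinearMap.add_apply, ← hx, ← hy]; abel
    | hmul v x hx =>
      simp only [O.inner_odd hb, O.inner_even hc, O.inner_even hbc, map_add, LinearMap.add_apply,
        O.par_br, hb, ← hx, ← h.jacobi_odd b c v hb, map_neg, mul_sub,
        sub_mul, map_sub, LinearMap.neg_apply, neg_neg]
      abel
  | hod c hc =>
    have hbc : P.op (O.br b c) = -O.br b c := by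
      rw [O.par_br, hb, hc, map_neg, map_neg, LinearMap.neg_apply, neg_neg]
    induction x using SuperSym.inductionLeft with
    | h1 => simp only [inner_one, map_zero, LinearMap.zero_apply, sub_zero]
    | hsmul r x hx => simp only [map_smul, LinearMap.smul_apply, ← hx, smul_sub]
    | hadd x y hx hy => simp only [map_add, LinearMap.add_apply, ← hx, ← hy]; abel
    | hmul v x hx =>
      simp only [O.inner_odd hb, O.inner_odd hc, O.inner_odd hbc, map_add, LinearMap.add_apply,
        ← hx, ← h.jacobi_odd b c v hb, mul_sub, sub_mul, map_sub]
      abel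

/-- This is the derivation property with a single functional as first argument, the case from which
the vanishing of the squared Laplacian follows. On a product, `lap_br` handles the Laplacian of the
bracket with one factor, and the Jacobi identity handles the double brackets. -/
theorem IsDGLie.laplacian_inner (h : O.IsDGLie) (b : V) (x : SuperSym P) :
    O.laplacian (O.inner x b) = O.inner x (O.lap b) - O.inner (O.laplacian x) (P.op b) := by
  induction b using P.induction generalizing x with
  | hadd b c hb hc => simp only [map_add, hb, hc]; abel
  | hev b hb =>
    have hl : P.op (O.lap b) = -O.lap b := by rw [O.par_lap, hb]
    rw [hb]
    induction x using SuperSym.inductionLeft with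
    | h1 => simp only [inner_one, laplacian_one, map_zero, LinearMap.zero_apply, sub_zero]
    | hsmul r x hx => simp only [map_smul, LinearMap.smul_apply, hx, smul_sub]
    | hadd x y hx hy => simp only [map_add, LinearMap.add_apply, hx, hy]; abel
    | hmul v x hx =>
      -- The Laplacian of `ι P (O.br b v) * x` contributes the bracket of `O.br b (P.op v)` with
      -- `x`, up to sign. The Jacobi identity splits it: one half cancels against the Laplacian of
      -- `ι P (P.op v) * O.inner x b`, and the other is needed on the right-hand side.
      have hj := h.inner_inner_even hb (P.op v) x
      rw [P.op_op] at hj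
      simp only [O.inner_even hb, O.inner_odd hl, laplacian_ι_mul, map_add, map_sub, map_neg,
        LinearMap.add_apply, O.par_br, O.par_lap, hb, hx, h.lap_br, ← hj, P.op_op, mul_sub,
        sub_mul, neg_mul]
      abel
  | hod b hb =>
    have hl : P.op (O.lap b) = O.lap b := by rw [O.par_lap, hb, map_neg, neg_neg]
    rw [hb]
    induction x using SuperSym.inductionLeft with
    | h1 => simp only [inner_one, laplacian_one, map_zero, LinearMap.zero_apply, sub_zero]
    | hsmul r x hx => simp only [map_smul, LinearMap.smul_apply, hx, smul_sub]
    | hadd x y hx hy => simp only [map_add, LinearMap.add_apply, hx, hy]; abel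
    | hmul v x hx =>
      have hj := h.inner_inner_odd hb (P.op v) x
      simp only [O.inner_odd hb, O.inner_even hl, laplacian_ι_mul, map_add, map_sub, map_neg,
        LinearMap.add_apply, LinearMap.neg_apply, O.par_br, hb, hx, h.lap_br, ← hj,
        mul_sub, sub_mul, neg_mul, neg_neg, mul_neg]
      abel

/-- This is the Chevalley–Eilenberg fact that the differential of a differential graded Lie algebra
squares to zero. The Jacobi identity enters through `laplacian_inner`, after which the terms cancel
in pairs. -/
theorem IsDGLie.laplacian_laplacian (h : O.IsDGLie) (x : SuperSym P) :
    O.laplacian (O.laplacian x) = 0 := by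
  induction x using SuperSym.inductionLeft with
  | h1 => rw [laplacian_one, map_zero]
  | hsmul r x hx => simp only [map_smul, hx, smul_zero]
  | hadd x y hx hy => simp only [map_add, hx, hy, add_zero]
  | hmul v x hx =>
    simp only [laplacian_ι_mul, map_add, h.laplacian_inner, h.lap_lap, O.par_lap, P.op_op, hx,
      map_zero, zero_mul, mul_zero, map_neg, neg_mul]
    abel

variable (O)

/-- The recursion prescribes the product rule only for a single functional on the left. Peeling
factors off `F` works because $⟦v,\cdot⟧$ is a graded derivation; the terms it produces are those in
the recursion for `schouten`. -/
theorem laplacian_mul (F G : SuperSym P) : O.laplacian (F * G) =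
    O.laplacian F * G + O.schouten ((par P).op F) G + (par P).op F * O.laplacian G := by
  induction F using SuperSym.inductionLeft with
  | h1 =>
    rw [laplacian_one, par_one, schouten_one, one_mul, one_mul, zero_mul, zero_add, zero_add]
  | hsmul r x hx => simp only [map_smul, smul_mul_assoc, LinearMap.smul_apply, hx, smul_add]
  | hadd x y hx hy => simp only [map_add, add_mul, LinearMap.add_apply, hx, hy]; abel
  | hmul v x hx =>
    induction v using P.induction with
    | hadd v w hv hw => simp only [map_add, add_mul, LinearMap.add_apply, hv, hw]; abel
    | hev v hv =>
      obtain ⟨e1, e2⟩ := P.ev_even hv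
      simp only [mul_assoc, laplacian_ι_mul, par_mul, par_ι, schouten_ι_mul, hx, hv, e1, e2,
        O.inner_mul_even hv, map_zero, mul_zero, mul_add, add_mul]
      abel
    | hod v hv =>
      obtain ⟨e1, e2⟩ := P.ev_odd hv
      simp only [mul_assoc, laplacian_ι_mul, par_mul, par_ι, schouten_ι_mul, hx, hv, e1, e2,
        O.inner_mul_odd hv, map_zero, mul_zero, mul_add, add_mul, map_neg, neg_mul,
        LinearMap.neg_apply, Parity.op_op]
      abel

/-- The argument used for integral functionals is repeated with the formal product in place of the
product of legs. -/
theorem IsDGLie.laplacian_schouten {O : BlockOps P} (h : O.IsDGLie) (F G : SuperSym P) :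
    O.laplacian (O.schouten F G) =
      O.schouten (O.laplacian F) G - O.schouten ((par P).op F) (O.laplacian G) :=
  lap_bracket_of_sq_zero (fun x => (O.par_laplacian_inner x).2) h.laplacian_laplacian
    O.laplacian_mul F G

end BlockOps

/-! ### Normalized test shifts. -/

section Normalized

variable {𝕜 : Type} [RCLike 𝕜] {n : ℕ} {U : TopologicalSpace.Opens (Fin n → ℝ)} {m N : ℕ}

theorem TestShift.IsNormalized.coeff_eq_one {δs : TestShift 𝕜 U N} (h : δs.IsNormalized) :
    (fun i => (Block.coeff (δs.even i * δs.odd i) : Block 𝕜 U m N)) = 1 :=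
  funext fun i => congrArg Block.coeff (h i)

theorem TestShift.IsNormalized.lap_eq {δs : TestShift 𝕜 U N} (h : δs.IsNormalized) :
    (blockOps m δs).lap = lapOf 1 Block.varQ Block.varQd :=
  congrArg (fun w => lapOf w Block.varQ Block.varQd) h.coeff_eq_one

theorem TestShift.IsNormalized.br_eq {δs : TestShift 𝕜 U N} (h : δs.IsNormalized) :
    (blockOps m δs).br = brOf (Block.par 𝕜 U m N) 1 Block.varQ Block.varQd :=
  congrArg (fun w => brOf (Block.par 𝕜 U m N) w Block.varQ Block.varQd) h.coeff_eq_one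

/-- With normalized test shifts, the operations do not depend on the shift. -/
theorem TestShift.IsNormalized.blockOps_eq {δs₁ δs₂ : TestShift 𝕜 U N} (h₁ : δs₁.IsNormalized)
    (h₂ : δs₂.IsNormalized) : blockOps m δs₁ = blockOps m δs₂ := by
  have hw := (h₁.coeff_eq_one (m := m)).trans h₂.coeff_eq_one.symm
  unfold blockOps
  -- The test shift enters the operations only through the weights, which `hw` equates.
  congr 1

theorem TestShift.IsNormalized.isDGLie {δs : TestShift 𝕜 U N} (h : δs.IsNormalized) :
    (blockOps m δs).IsDGLie := by
  refine BlockOps.isDGLie_of_sq_zero _ ?_ ?_ ?_ ?_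
  · rw [h.lap_eq]
    exact lapOf_lapOf Block.varQ_varQ Block.varQ_varQd Block.varQd_varQd
  · rw [h.lap_eq, h.br_eq]
    exact lapOf_mul Block.varQ_mul Block.varQd_mul
  · rw [h.br_eq]
    exact fun a b c ha => brOf_mul_even (Block.superComm 𝕜 U m N) Block.par_varQ Block.par_varQd
      Block.varQ_mul Block.varQd_mul ha b c
  · rw [h.br_eq]
    exact fun a b c ha => brOf_mul_odd (Block.superComm 𝕜 U m N) Block.par_varQ Block.par_varQd
      Block.varQ_mul Block.varQd_mul ha b c

end Normalized

end BV

/-! ### The derivation property before and after evaluation. -/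

theorem mainTheorem2 {𝕜 : Type} [RCLike 𝕜] {n : ℕ} (U : TopologicalSpace.Opens (Fin n → ℝ))
    (m N : ℕ) (δs₁ δs₂ : BV.TestShift 𝕜 U N) (h₁ : δs₁.IsNormalized) (h₂ : δs₂.IsNormalized)
    (a : ℤ) :
    (∀ F G : BV.Block 𝕜 U m N, (BV.Block.par 𝕜 U m N).IsHomogeneous a F →
      (BV.blockOps m δs₁).lap ((BV.blockOps m δs₂).br F G) =
        (BV.blockOps m δs₂).br ((BV.blockOps m δs₁).lap F) G +
          (-1 : 𝕜) ^ (a - 1) • (BV.blockOps m δs₂).br F ((BV.blockOps m δs₁).lap G)) ∧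
    (∀ F G : BV.Functional 𝕜 U m N, (BV.Functional.par 𝕜 U m N).IsHomogeneous a F →
      BV.laplacian δs₁ (BV.schouten δs₂ F G) =
        BV.schouten δs₂ (BV.laplacian δs₁ F) G +
          (-1 : 𝕜) ^ (a - 1) • BV.schouten δs₂ F (BV.laplacian δs₁ G)) ∧
    (∀ (ρ : BV.DiffFun 𝕜 U (Fin m ⊕ Fin N)) (F G : BV.Functional 𝕜 U m N),
      (BV.Functional.par 𝕜 U m N).IsHomogeneous a F →
      BV.realize ρ (BV.laplacian δs₁ (BV.schouten δs₂ F G)) =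
        BV.realize ρ (BV.schouten δs₂ (BV.laplacian δs₁ F) G) +
          (-1 : 𝕜) ^ (a - 1) • BV.realize ρ (BV.schouten δs₂ F (BV.laplacian δs₁ G))) := by
  have hfun : ∀ F G : BV.Functional 𝕜 U m N, (BV.Functional.par 𝕜 U m N).IsHomogeneous a F →
      BV.laplacian δs₁ (BV.schouten δs₂ F G) =
        BV.schouten δs₂ (BV.laplacian δs₁ F) G +
          (-1 : 𝕜) ^ (a - 1) • BV.schouten δs₂ F (BV.laplacian δs₁ G) := by
    intro F G hF
    unfold BV.laplacian BV.schouten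
    -- From here on both operations carry one and the same shift; homogeneity then turns the parity
    -- involution into the sign $(-1)^{a-1}$.
    rw [← h₁.blockOps_eq h₂]
    exact hF.eq_add_smul (BV.blockOps m δs₁).schouten
      (h₁.isDGLie.laplacian_schouten (O := BV.blockOps m δs₁) F G)
  refine ⟨fun F G hF => ?_, hfun, fun ρ F G hF => ?_⟩
  · rw [← h₁.blockOps_eq h₂]
    exact hF.eq_add_smul (BV.blockOps m δs₁).br (h₁.isDGLie.lap_br F G)
  -- The equality already holds before total divergences are discarded, so linearity of `realize ρ`
  -- suffices.
  · rw [hfun F G hF, map_add, map_smul]
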